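/- Let $\Delta = 2k \ge 2$ be an even constant. A $\Delta$-regular tree is a finite tree in which every node has degree $\Delta$, except for the leaves, which have degree $1$. A weak $2$-coloring assigns one of two colors to every node such that every node has at least one neighbor of the other color. Consider randomized algorithms in the LOCAL model: the nodes of an $n$-node $\Delta$-regular tree know $n$ and $\Delta$, have private sequences of independent unbiased random bits, and communicate in synchronous rounds with unbounded messages and unbounded local computation. Each node is also given an identifier, where the identifiers of the $n$ nodes are exactly $\{1,\dots,n\}$, and a consistent orientation of the $k$ dimensions: every edge is labeled at each of its endpoints with one of the $2k$ directions $(d,\pm)$, $d \in \{1,\dots,k\}$, such that different edges at a node get different directions and an edge that has direction $(d,+)$ for one endpoint has direction $(d,-)$ for the other. Then computing a weak $2$-coloring with global success probability at least $\tfrac12$ requires $\Omega(\log^* n)$ rounds. That is, there are a constant $c>0$ and an $n_0$, depending only on $\Delta$, such that for every $n \ge n_0$ for which an $n$-node $\Delta$-regular tree exists, every such algorithm and every $T$: if on every $n$-node $\Delta$-regular tree, with every consistent orientation and every assignment of the identifiers $1,\dots,n$, it holds with probability at least $\tfrac12$ that all nodes halt within $T$ rounds and their outputs form a weak $2$-coloring,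 then $T \ge c \log^* n$. -/

import Mathlib

open MeasureTheory

/-- The iterated logarithm to base `2`: the least number of times that `log₂` has to be applied
to `x` before the result is at most `1`. -/
noncomputable def logStar (x : ℝ) : ℕ :=
  sInf {i : ℕ | (Real.logb 2)^[i] x ≤ 1}

/-- A (finite) `Δ`-regular tree: a tree in which every node has degree `Δ`, except for the
leaves, which have degree `1`. -/
def IsRegularTree {V : Type} (Δ : ℕ) (G : SimpleGraph V) : Prop :=
  G.IsTree ∧ ∀ v, (G.neighborSet v).ncard = Δ ∨ (G.neighborSet v).ncard = 1

/-- A weak coloring: every node has at least one neighbor of a different color. -/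
def IsWeakColoring {V C : Type} (G : SimpleGraph V) (φ : V → C) : Prop :=
  ∀ v, ∃ u, G.Adj v u ∧ φ u ≠ φ v

/-- The `2k` directions in `k` dimensions: a dimension together with a sign. -/
abbrev Direction (k : ℕ) : Type := Fin k × Bool

/-- The opposite direction in the same dimension. -/
def Direction.opp {k : ℕ} (p : Direction k) : Direction k := (p.1, !p.2)

/-- A consistent orientation of the edges of `G` along `k` dimensions. Every edge at a node `u`
has exactly one direction as seen from `u`, different edges at `u` have different directions, and
an edge that has direction `p` for `u` has the opposite direction for its other endpoint.
`nbr u p` is the neighbor of `u` in direction `p`, if there is one. -/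
structure ConsistentOrientation {V : Type} (k : ℕ) (G : SimpleGraph V) where
  nbr : V → Direction k → Option V
  adj_iff : ∀ u v, G.Adj u v ↔ ∃ p, nbr u p = some v
  unique : ∀ u v p q, nbr u p = some v → nbr u q = some v → p = q
  consistent : ∀ u v p, nbr u p = some v → nbr v p.opp = some u

/-- An input network on `n` nodes: a `2k`-regular tree together with a consistent orientation
of the `k` dimensions and with unique identifiers that are exactly `1, …, n`. -/
structure Network (k n : ℕ) where
  graph : SimpleGraph (Fin n)
  regular : IsRegularTree (2 * k) graph
  orientation : ConsistentOrientation k graph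
  ident : Fin n → ℕ
  ident_bij : Set.BijOn ident Set.univ (Set.Icc 1 n)

/-- A randomized algorithm with outputs in `C` in the LOCAL model, for networks whose edges are
oriented along `k` dimensions. Neither the memory, nor the size of the messages, nor the power of
the local computations is bounded.

* `init n i P r` is the initial state of a node with identifier `i` in a network of `n` nodes,
  where `P` is the set of directions in which the node has a neighbor (so the node knows its
  degree), and `r` is its private sequence of random bits;
* `send s p` is the message that a node in state `s` sends in direction `p`;
* `receive s m` is the new state of a node in state `s` that gets the messages `m` (where
  `m p = none` if no message arrives from direction `p`);
* `output s = some c` means that a node in state `s` has halted with output `c`. -/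
structure LocalAlgorithm (k : ℕ) (C : Type) where
  State : Type
  Msg : Type
  init : ℕ → ℕ → Set (Direction k) → (ℕ → Bool) → State
  send : State → Direction k → Msg
  receive : State → (Direction k → Option Msg) → State
  output : State → Option C

namespace LocalAlgorithm

variable {k : ℕ} {C : Type}

/-- The states of all nodes after `t` synchronous rounds, if `ω v` is the sequence of random bits
of the node `v`. A node that has halted keeps its state and sends no messages any more. -/
def stateAfter (A : LocalAlgorithm k C) {n : ℕ} (N : Network k n) (ω : Fin n → ℕ → Bool) :
    ℕ → Fin n → A.State
  | 0, v => A.init n (N.ident v) {p | N.orientation.nbr v p ≠ none} (ω v)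
  | t + 1, v =>
    if (A.output (A.stateAfter N ω t v)).isSome then A.stateAfter N ω t v
    else A.receive (A.stateAfter N ω t v) fun p =>
      match N.orientation.nbr v p with
      | none => none
      | some u =>
        if (A.output (A.stateAfter N ω t u)).isSome then none
        else some (A.send (A.stateAfter N ω t u) p.opp)

/-- The output of the node `v` if it has halted within `T` rounds, and `none` otherwise. -/
def outputAfter (A : LocalAlgorithm k C) {n : ℕ} (N : Network k n) (T : ℕ) (v : Fin n)
    (ω : Fin n → ℕ → Bool) : Option C :=
  A.output (A.stateAfter N ω T v)

end LocalAlgorithm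

/-- The law of an infinite sequence of independent unbiased random bits. -/
noncomputable def coinFlips : Measure (ℕ → Bool) :=
  Measure.infinitePi fun _ : ℕ => (PMF.uniformOfFintype Bool).toMeasure

/-- The law of the random bits in a network of `n` nodes: every node has its own sequence of
unbiased bits, and these sequences are independent. -/
noncomputable def randomBits (n : ℕ) : Measure (Fin n → ℕ → Bool) :=
  Measure.pi fun _ : Fin n => coinFlips

/-- The event that all nodes of the network `N` halt within `T` rounds, and that their outputs
form a weak coloring. -/
def LocalAlgorithm.successEvent {k : ℕ} {C : Type} (A : LocalAlgorithm k C) {n : ℕ}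
    (N : Network k n) (T : ℕ) : Set (Fin n → ℕ → Bool) :=
  {ω | ∃ φ : Fin n → C, (∀ v, A.outputAfter N T v ω = some (φ v)) ∧ IsWeakColoring N.graph φ}

/-- The algorithm `A` finds, on every network with `n` nodes, a weak coloring within `T` rounds
with global success probability at least `q`. That the outputs are random variables is part of
the definition. -/
def LocalAlgorithm.FindsWeakColoring {k : ℕ} {C : Type} (A : LocalAlgorithm k C) (n T : ℕ)
    (q : ENNReal) : Prop :=
  ∀ N : Network k n,
    (∀ v c, MeasurableSet {ω | A.outputAfter N T v ω = some c}) ∧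
      q ≤ randomBits n (A.successEvent N T)

/-! The core is round elimination on the infinite `2k`-regular tree, realized as the free group on
`k` generators with i.i.d. labels from a finite set. Let `f` be a coloring of radius `R + 1`. The
labels within distance `R` of an edge determine which colors each endpoint is likely to get; this
pair of color sets is the type of the edge. The labels within distance `R` of a node determine which
types its edges are likely to have; this is the new color `likelyTypes`, of radius `R`.

Suppose that the new coloring is monochromatic at a node. Up to a small error, the type of an edge
is likely as seen from each of its ends, so by the consistent orientation a type can be chosen in
one direction of each dimension such that both it and, in the opposite direction, its reverse are
likely at the node. Given the ball of radius `R`, the edges are independent, so all of them have the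
chosen types with probability at least `δ' ^ (2 * k)`. Then a color that every edge finds likely for
the node is likely for all neighbors too, and with conditional probability at least `δ ^ (2 * k)`
they all take it. Hence, if `f` is rarely monochromatic, so is `likelyTypes`
(`measureReal_monochromatic_likelyTypes_le`). At radius `0` the colors are independent and
pigeonhole gives a lower bound. Going back up, every coloring of radius `R` is monochromatic with
probability at least `1 / Y`, where `Y` is a tower of height `O(R)`
(`inv_iteratedExp_le_measureReal_monochromatic`).

To reach finite networks with unique identifiers, attach the random bits to the identifiers and fix
them by averaging, so that the identifiers are the only labels. Place `2 * Y` disjoint balls in a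
regular tree that is a piece of the Cayley graph. At least half of the injective labelings of these
balls succeed (`exists_descFactorial_le`), and for large `n` at least half of all labelings are
injective. But each ball avoids the monochromatic labelings in at most a fraction `1 - 1 / Y` of the
cases, so at most a fraction `exp (-2) < 1 / 4` of all labelings succeed. Thus `n` is below a tower
of height `O(T)`. -/

/-! ### Conditional probabilities and independence in product measures -/

section ProductMeasure

variable {ι X : Type*}

open Classical in
theorem dependsOn_mem_piecewise {S D : Set ι} {E : Set (ι → X)} (hE : DependsOn (· ∈ E) D)
    (x : ι → X) : DependsOn (· ∈ {y | S.piecewise x y ∈ E}) (D \ S) := by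
  intro y y' h
  refine hE fun i hi => ?_
  by_cases hS : i ∈ S
  · simp [hS]
  · simp [hS, h i ⟨hi, hS⟩]

variable [MeasurableSpace X] {ν : Measure X}

open Classical in
theorem measurable_piecewise_prod (S : Set ι) :
    Measurable fun z : (ι → X) × (ι → X) => S.piecewise z.1 z.2 := by
  refine measurable_pi_lambda _ fun i => ?_
  by_cases h : i ∈ S
  · simp only [Set.piecewise, h, if_true]; fun_prop
  · simp only [Set.piecewise, h, if_false]; fun_prop

open Classical in
/-- The probability of `E` if the coordinates in `S` are those of `x` and all others are random. -/
noncomputable def condProb (ν : Measure X) (S : Set ι) (E : Set (ι → X)) (x : ι → X) : ℝ :=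
  (Measure.infinitePi fun _ : ι => ν).real {y | S.piecewise x y ∈ E}

open Classical in
theorem condProb_congr {S S' : Set ι} {E E' : Set (ι → X)} {x x' : ι → X}
    (h : ∀ y, S.piecewise x y ∈ E ↔ S'.piecewise x' y ∈ E') :
    condProb ν S E x = condProb ν S' E' x' := by
  simp only [condProb, h]

theorem dependsOn_condProb (S : Set ι) (E : Set (ι → X)) : DependsOn (condProb ν S E) S := by
  classical
  intro x x' h
  refine condProb_congr fun y => ?_
  rw [show S.piecewise x y = S.piecewise x' y from ?_]
  ext i
  by_cases hi : i ∈ S <;> simp [hi, h]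

variable [IsProbabilityMeasure ν]

open Classical in
/-- Resampling the coordinates outside `S` does not change a product measure. -/
theorem map_piecewise_infinitePi (S : Set ι) :
    ((Measure.infinitePi fun _ : ι => ν).prod (Measure.infinitePi fun _ : ι => ν)).map
      (fun z => S.piecewise z.1 z.2) = Measure.infinitePi fun _ : ι => ν := by
  refine Measure.eq_infinitePi _ fun s t ht => ?_
  rw [Measure.map_apply (measurable_piecewise_prod S)
    (.pi s.countable_toSet fun _ _ => ht _)]
  have : (fun z : (ι → X) × (ι → X) => S.piecewise z.1 z.2) ⁻¹' (s : Set ι).pi t =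
      ((s.filter (· ∈ S) : Finset ι) : Set ι).pi t ×ˢ
        ((s.filter (· ∉ S) : Finset ι) : Set ι).pi t := by
    ext z
    simp only [Set.mem_preimage, Set.mem_pi, Set.mem_prod, Finset.coe_filter, Set.mem_ofPred_eq,
      Set.piecewise, Finset.mem_coe]
    constructor
    · intro h
      exact ⟨fun i hi => by simpa [hi.2] using h i hi.1, fun i hi => by simpa [hi.2] using h i hi.1⟩
    · rintro ⟨h₁, h₂⟩ i hi
      by_cases hS : i ∈ S
      · simpa [hS] using h₁ i ⟨hi, hS⟩
      · simpa [hS] using h₂ i ⟨hi, hS⟩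
  rw [this, Measure.prod_prod, Measure.infinitePi_pi _ fun i _ => ht i,
    Measure.infinitePi_pi _ fun i _ => ht i, Finset.prod_filter_mul_prod_filter_not]

variable {β : Type*} [DiscreteMeasurableSpace X] [Finite X]

/-- A function of finitely many coordinates with discrete finite range of values is measurable. -/
theorem DependsOn.measurable_of_finite [MeasurableSpace β] {f : (ι → X) → β} {S : Set ι}
    (hf : DependsOn f S) (hS : S.Finite) : Measurable f := by
  obtain _ | ⟨⟨x₀⟩⟩ := isEmpty_or_nonempty (ι → X)
  · exact measurable_of_empty f
  have : Nonempty β := ⟨f x₀⟩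
  obtain ⟨g, rfl⟩ := dependsOn_iff_exists_comp.1 hf
  have := hS.to_subtype
  have hd : DiscreteMeasurableSpace (S → X) := by
    infer_instance
  exact (Measurable.of_discrete (f := g)).comp (by fun_prop)

theorem DependsOn.measurableSet_of_finite {E : Set (ι → X)} {S : Set ι}
    (hE : DependsOn (· ∈ E) S) (hS : S.Finite) : MeasurableSet E :=
  measurableSet_setOfPred.2 (hE.measurable_of_finite hS)

/-- This is the tower property. By `map_piecewise_infinitePi`, the coordinates inside and outside
`S` may come from two independent samples; Tonelli integrates out the second one, which `Q` does not
see. -/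
theorem lintegral_condProb {S D : Set ι} {E Q : Set (ι → X)} (hE : DependsOn (· ∈ E) D)
    (hD : D.Finite) (hQ : DependsOn (· ∈ Q) S) (hS : S.Finite) :
    ∫⁻ x in Q, ENNReal.ofReal (condProb ν S E x) ∂(Measure.infinitePi fun _ : ι => ν) =
      (Measure.infinitePi fun _ : ι => ν) (E ∩ Q) := by
  classical
  have hEm := hE.measurableSet_of_finite hD
  have hQm := hQ.measurableSet_of_finite hS
  conv_rhs => rw [← map_piecewise_infinitePi (ν := ν) S]
  rw [Measure.map_apply (measurable_piecewise_prod S) (hEm.inter hQm),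
    Measure.prod_apply (measurable_piecewise_prod S (hEm.inter hQm)), ← lintegral_indicator hQm]
  refine lintegral_congr fun x => ?_
  have key : ∀ y, S.piecewise x y ∈ Q ↔ x ∈ Q := fun y =>
    iff_of_eq (hQ fun i hi => by simp [hi])
  by_cases hx : x ∈ Q
  · rw [Set.indicator_of_mem hx, condProb, Measure.real, ENNReal.ofReal_toReal (measure_ne_top _ _)]
    congr 1
    ext y
    simp [key, hx]
  · rw [Set.indicator_of_notMem hx, eq_comm]
    convert! measure_empty (μ := Measure.infinitePi fun _ : ι => ν)
    ext y
    simp [key, hx]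

/-- A lower bound on all conditional probabilities is a lower bound on the probability. -/
theorem mul_measureReal_le_of_le_condProb {S D : Set ι} {E Q : Set (ι → X)} {δ : ℝ}
    (hE : DependsOn (· ∈ E) D) (hD : D.Finite) (hQ : DependsOn (· ∈ Q) S) (hS : S.Finite)
    (hδ : 0 ≤ δ) (h : ∀ x ∈ Q, δ ≤ condProb ν S E x) :
    δ * (Measure.infinitePi fun _ : ι => ν).real Q ≤
      (Measure.infinitePi fun _ : ι => ν).real (E ∩ Q) := by
  have h1 : ∫⁻ _ in Q, ENNReal.ofReal δ ∂(Measure.infinitePi fun _ : ι => ν) ≤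
      (Measure.infinitePi fun _ : ι => ν) (E ∩ Q) := by
    rw [← lintegral_condProb hE hD hQ hS]
    exact setLIntegral_mono' (hQ.measurableSet_of_finite hS) fun x hx =>
      ENNReal.ofReal_le_ofReal (h x hx)
  rw [setLIntegral_const] at h1
  have h2 := ENNReal.toReal_mono (measure_ne_top _ _) h1
  rwa [ENNReal.toReal_mul, ENNReal.toReal_ofReal hδ] at h2

/-- An upper bound on all conditional probabilities is an upper bound on the probability. -/
theorem measureReal_le_mul_of_condProb_le {S D : Set ι} {E Q : Set (ι → X)} {δ : ℝ}
    (hE : DependsOn (· ∈ E) D) (hD : D.Finite) (hQ : DependsOn (· ∈ Q) S) (hS : S.Finite)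
    (hδ : 0 ≤ δ) (h : ∀ x ∈ Q, condProb ν S E x ≤ δ) :
    (Measure.infinitePi fun _ : ι => ν).real (E ∩ Q) ≤
      δ * (Measure.infinitePi fun _ : ι => ν).real Q := by
  have h1 : (Measure.infinitePi fun _ : ι => ν) (E ∩ Q) ≤
      ∫⁻ _ in Q, ENNReal.ofReal δ ∂(Measure.infinitePi fun _ : ι => ν) := by
    rw [← lintegral_condProb hE hD hQ hS]
    exact setLIntegral_mono' (hQ.measurableSet_of_finite hS) fun x hx =>
      ENNReal.ofReal_le_ofReal (h x hx)
  rw [setLIntegral_const] at h1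
  have h2 := ENNReal.toReal_mono (by finiteness) h1
  rwa [ENNReal.toReal_mul, ENNReal.toReal_ofReal hδ] at h2

/-- It is unlikely to see an event that was unlikely. -/
theorem measureReal_inter_condProb_lt_le {S D : Set ι} {E : Set (ι → X)} {δ : ℝ}
    (hE : DependsOn (· ∈ E) D) (hD : D.Finite) (hS : S.Finite) (hδ : 0 ≤ δ) :
    (Measure.infinitePi fun _ : ι => ν).real {x | x ∈ E ∧ ¬ δ ≤ condProb ν S E x} ≤ δ := by
  refine (measureReal_le_mul_of_condProb_le (Q := {x | ¬ δ ≤ condProb ν S E x}) hE hD ?_ hS hδ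
    fun x hx => (not_le.1 hx).le).trans (mul_le_of_le_one_right hδ measureReal_le_one)
  intro x y h
  simp [dependsOn_condProb (ν := ν) S E h]

theorem measureReal_inter_of_disjoint {D D' : Set ι} {E E' : Set (ι → X)}
    (hE : DependsOn (· ∈ E) D) (hD : D.Finite) (hE' : DependsOn (· ∈ E') D') (hD' : D'.Finite)
    (hdisj : Disjoint D D') :
    (Measure.infinitePi fun _ : ι => ν).real (E ∩ E') =
      (Measure.infinitePi fun _ : ι => ν).real E * (Measure.infinitePi fun _ : ι => ν).real E' := by
  classical
  -- Fixing the coordinates in `D'` does not affect `E`, so its conditional probability is constant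
  -- and the upper and lower bounds coincide.
  have h : ∀ x, condProb ν D' E x = (Measure.infinitePi fun _ : ι => ν).real E := fun x => by
    rw [condProb]
    congr 1
    ext y
    exact iff_of_eq (hE fun i hi => by simp [Set.disjoint_left.1 hdisj hi])
  exact le_antisymm
    (measureReal_le_mul_of_condProb_le hE hD hE' hD' measureReal_nonneg fun x _ => (h x).le)
    (mul_measureReal_le_of_le_condProb hE hD hE' hD' measureReal_nonneg fun x _ => (h x).ge)

/-- Events that depend on disjoint sets of coordinates are independent. -/
theorem measureReal_forall_mem_of_disjoint {α : Type*} [Fintype α] {D : α → Set ι}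
    {E : α → Set (ι → X)} (hE : ∀ a, DependsOn (· ∈ E a) (D a)) (hD : ∀ a, (D a).Finite)
    (hdisj : ∀ a b, a ≠ b → Disjoint (D a) (D b)) :
    (Measure.infinitePi fun _ : ι => ν).real {x | ∀ a, x ∈ E a} =
      ∏ a, (Measure.infinitePi fun _ : ι => ν).real (E a) := by
  classical
  suffices h : ∀ s : Finset α, (Measure.infinitePi fun _ : ι => ν).real {x | ∀ a ∈ s, x ∈ E a} =
      ∏ a ∈ s, (Measure.infinitePi fun _ : ι => ν).real (E a) by simpa using h Finset.univ
  intro s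
  induction s using Finset.induction_on with
  | empty => simp
  | insert a s ha ih =>
    rw [Finset.prod_insert ha, ← ih, ← measureReal_inter_of_disjoint (hE a) (hD a)
      (D' := ⋃ b ∈ s, D b) _ (s.finite_toSet.biUnion fun b _ => hD b)]
    · congr 1
      ext x
      simp
    · rw [Set.disjoint_iUnion₂_right]
      exact fun b hb => hdisj a b fun h => ha (h ▸ hb)
    · intro x y h
      simp only [Set.mem_ofPred_eq, eq_iff_iff]
      exact forall₂_congr fun b hb => iff_of_eq (hE b fun i hi => h i (Set.mem_biUnion hb hi))

/-- Conditionally on the coordinates in `S`, events that depend on sets of coordinates that are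
disjoint outside `S` are independent. -/
theorem condProb_forall_mem_of_disjoint {α : Type*} [Fintype α] {S : Set ι} {D : α → Set ι}
    {E : α → Set (ι → X)} (hE : ∀ a, DependsOn (· ∈ E a) (D a)) (hD : ∀ a, (D a).Finite)
    (hdisj : ∀ a b, a ≠ b → D a ∩ D b ⊆ S) (x : ι → X) :
    condProb ν S {x | ∀ a, x ∈ E a} x = ∏ a, condProb ν S (E a) x := by
  classical
  refine measureReal_forall_mem_of_disjoint (fun a => dependsOn_mem_piecewise (hE a) x)
    (fun a => (hD a).sdiff) fun a b hab => Set.disjoint_left.2 fun i hi hi' => hi.2 ?_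
  exact hdisj a b hab ⟨hi.1, hi'.1⟩

end ProductMeasure

/-! ### The free group as a tree: norms and balls -/

theorem Direction.opp_opp {k : ℕ} (p : Direction k) : p.opp.opp = p := by
  simp [Direction.opp]

namespace FreeGroup

variable {k : ℕ}

/-- The element of the free group that corresponds to a direction. -/
def gen (p : Direction k) : FreeGroup (Fin k) := mk [p]

theorem gen_opp (p : Direction k) : gen p.opp = (gen p)⁻¹ := by
  simp [gen, Direction.opp, inv_mk, invRev]

theorem toWord_gen_mul (p : Direction k) (w : FreeGroup (Fin k)) :
    (gen p * w).toWord = p :: w.toWord ∨ w.toWord = p.opp :: (gen p * w).toWord := by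
  have h : (gen p * w).toWord = reduce (p :: w.toWord) := by
    rw [gen, toWord_mul, toWord_mk, reduce_singleton, List.singleton_append]
  rw [h, reduce.cons, reduce_toWord]
  rcases hw : w.toWord with _ | ⟨q, l⟩
  · simp
  · by_cases hq : p.1 = q.1 ∧ p.2 = !q.2
    · right
      simp only [hq, and_self, if_true]
      congr 1
      ext <;> simp [Direction.opp, hq]
    · left
      simp [hq]

theorem norm_gen_mul (p : Direction k) (w : FreeGroup (Fin k)) :
    (gen p * w).norm = w.norm + 1 ∨ w.norm = (gen p * w).norm + 1 := by
  rcases toWord_gen_mul p w with h | h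
  · left; rw [norm, h]; rfl
  · right; rw [norm, h]; rfl

theorem norm_gen_mul_le (p : Direction k) (w : FreeGroup (Fin k)) :
    (gen p * w).norm ≤ w.norm + 1 := by
  have := norm_gen_mul p w
  omega

/-- Only cancelling the first letter of the reduced word of `w` shortens it. This uniqueness is what
makes the Cayley graph a tree. -/
theorem eq_of_norm_gen_mul {p q : Direction k} {w : FreeGroup (Fin k)}
    (hp : w.norm = (gen p * w).norm + 1) (hq : w.norm = (gen q * w).norm + 1) : p = q := by
  have key : ∀ r : Direction k, w.norm = (gen r * w).norm + 1 →
      w.toWord = r.opp :: (gen r * w).toWord := fun r hr => by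
    refine (toWord_gen_mul r w).resolve_left fun h => ?_
    have := congrArg List.length h
    simp only [List.length_cons] at this
    unfold norm at hr
    omega
  have h := (key p hp).symm.trans (key q hq)
  rw [← p.opp_opp, (List.cons.inj h).1, q.opp_opp]

theorem gen_injective : Function.Injective (gen : Direction k → FreeGroup (Fin k)) := by
  intro p q h
  have := congrArg toWord h
  simpa [gen, toWord_mk, reduce_singleton] using this

theorem gen_mul_ne (p : Direction k) (w : FreeGroup (Fin k)) : gen p * w ≠ w := fun h => by
  have := norm_gen_mul p w
  rw [h] at this
  omega

/-- The elements of norm at most `R` in the free group. -/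
def ball (k R : ℕ) : Set (FreeGroup (Fin k)) := {g | g.norm ≤ R}

theorem ball_mono {R R' : ℕ} (h : R ≤ R') : ball k R ⊆ ball k R' := fun _ hg => le_trans hg h

theorem exists_gen_mul_of_ne_one {g : FreeGroup (Fin k)} (hg : g ≠ 1) :
    ∃ (p : Direction k) (w : FreeGroup (Fin k)), g = gen p * w ∧ g.norm = w.norm + 1 := by
  rcases hw : g.toWord with _ | ⟨p, l⟩
  · exact absurd (toWord_eq_nil_iff.1 hw) hg
  · have hg' : g = gen p * mk l := by
      rw [← mk_toWord (x := g), hw, gen, mul_mk, List.singleton_append]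
    refine ⟨p, mk l, hg', (hg' ▸ norm_gen_mul p (mk l)).resolve_right fun h => ?_⟩
    have h1 : (mk l).norm ≤ l.length := norm_mk_le
    have h2 : g.norm = l.length + 1 := by rw [norm, hw]; rfl
    omega

theorem ball_succ_subset (k R : ℕ) :
    ball k (R + 1) ⊆ insert 1 (⋃ p : Direction k, (gen p * ·) '' ball k R) := by
  intro g hg
  by_cases h1 : g = 1
  · exact Or.inl h1
  · obtain ⟨p, w, rfl, hw⟩ := exists_gen_mul_of_ne_one h1
    exact Or.inr (Set.mem_iUnion.2 ⟨p, w, by simp only [ball, Set.mem_ofPred_eq] at hg ⊢; omega, rfl⟩)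

theorem ball_zero (k : ℕ) : ball k 0 = {1} := by
  ext g
  simp [ball]

theorem finite_ball (k R : ℕ) : (ball k R).Finite := by
  induction R with
  | zero => simp [ball_zero]
  | succ R ih =>
    exact ((Set.finite_iUnion fun p => ih.image _).insert 1).subset (ball_succ_subset k R)

theorem ncard_ball_le (k R : ℕ) : (ball k R).ncard ≤ (2 * k + 1) ^ R := by
  induction R with
  | zero => simp [ball_zero]
  | succ R ih =>
    have hf : (⋃ p : Direction k, (gen p * ·) '' ball k R).Finite :=
      Set.finite_iUnion fun p => (finite_ball k R).image _
    have h1 : (⋃ p : Direction k, (gen p * ·) '' ball k R).ncard ≤ 2 * k * (2 * k + 1) ^ R := by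
      refine (Set.ncard_iUnion_le_of_fintype _).trans ?_
      refine (Finset.sum_le_card_nsmul _ _ ((2 * k + 1) ^ R) fun p _ => ?_).trans_eq ?_
      · exact (Set.ncard_image_le (finite_ball k R)).trans ih
      · simp [mul_comm]
    calc (ball k (R + 1)).ncard ≤ _ := Set.ncard_le_ncard (ball_succ_subset k R) (hf.insert 1)
      _ ≤ 2 * k * (2 * k + 1) ^ R + 1 := (Set.ncard_insert_le _ _).trans (by omega)
      _ ≤ _ := by
        have : 1 ≤ (2 * k + 1) ^ R := Nat.one_le_pow _ _ (by omega)
        rw [pow_succ]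
        nlinarith

end FreeGroup

/-! ### Round elimination on the infinite tree -/

namespace FreeGroup

variable {k : ℕ} {X κ : Type*}

/-- The labeling `x` of the free group as seen from the neighbor of `1` in direction `p`. -/
def shift (p : Direction k) (x : FreeGroup (Fin k) → X) : FreeGroup (Fin k) → X :=
  fun g => x (gen p * g)

@[simp]
theorem shift_shift_opp (p : Direction k) (x : FreeGroup (Fin k) → X) :
    shift p (shift p.opp x) = x := by
  ext g
  simp [shift, gen_opp]

theorem dependsOn_comp_shift {f : (FreeGroup (Fin k) → X) → κ} {S : Set (FreeGroup (Fin k))}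
    (hf : DependsOn f S) (p : Direction k) :
    DependsOn (fun x => f (shift p x)) {g | gen p.opp * g ∈ S} := fun x y h =>
  hf fun g hg => h _ (by simpa [gen_opp] using hg)

/-- The elements of distance at most `R` from one of the endpoints of the edge at `1` in
direction `p`. -/
def edgeBall (p : Direction k) (R : ℕ) : Set (FreeGroup (Fin k)) :=
  {g | g ∈ ball k R ∨ gen p.opp * g ∈ ball k R}

theorem gen_opp_mul_mem_edgeBall {p : Direction k} {R : ℕ} {g : FreeGroup (Fin k)} :
    gen p.opp * g ∈ edgeBall p.opp R ↔ g ∈ edgeBall p R := by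
  rw [edgeBall, edgeBall, Set.mem_ofPred_eq, Set.mem_ofPred_eq, or_comm]
  simp [gen_opp]

theorem ball_subset_edgeBall (p : Direction k) (R : ℕ) : ball k R ⊆ edgeBall p R :=
  fun _ => Or.inl

theorem edgeBall_subset_ball (p : Direction k) (R : ℕ) : edgeBall p R ⊆ ball k (R + 1) := by
  rintro g (hg | hg)
  · exact ball_mono (Nat.le_succ R) hg
  · have := norm_gen_mul_le p (gen p.opp * g)
    simp only [ball, Set.mem_ofPred_eq] at hg ⊢
    rw [gen_opp, mul_inv_cancel_left, ← gen_opp] at this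
    omega

theorem finite_edgeBall (p : Direction k) (R : ℕ) : (edgeBall p R).Finite :=
  (finite_ball k (R + 1)).subset (edgeBall_subset_ball p R)

/-- The distances of a node to the two endpoints of an edge differ by exactly one, so they cannot
both be `R + 1`. -/
theorem shifted_ball_inter_ball_subset (p : Direction k) (R : ℕ) :
    {g | gen p.opp * g ∈ ball k (R + 1)} ∩ ball k (R + 1) ⊆ edgeBall p R := by
  rintro g ⟨h1, h2⟩
  have := norm_gen_mul p.opp g
  simp only [edgeBall, ball, Set.mem_ofPred_eq] at h1 h2 ⊢
  omega

/-- A node outside the ball that is within distance `R` of two neighbors of `1` would have two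
different first letters. This is the source of conditional independence. -/
theorem shifted_ball_inter_shifted_ball_subset {p q : Direction k} (hpq : p ≠ q) (R : ℕ) :
    {g | gen p.opp * g ∈ ball k R} ∩ {g | gen q.opp * g ∈ ball k R} ⊆ ball k R := by
  rintro g ⟨h1, h2⟩
  simp only [ball, Set.mem_ofPred_eq] at h1 h2 ⊢
  by_contra hg
  refine hpq ?_
  have hp := norm_gen_mul p.opp g
  have hq := norm_gen_mul q.opp g
  rw [← p.opp_opp, ← q.opp_opp, eq_of_norm_gen_mul (p := p.opp) (q := q.opp) (w := g)
    (by omega) (by omega)]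

theorem edgeBall_inter_edgeBall_subset {p q : Direction k} (hpq : p ≠ q) (R : ℕ) :
    edgeBall p R ∩ edgeBall q R ⊆ ball k R := by
  rintro g ⟨h1 | h1, h2 | h2⟩
  · exact h1
  · exact h1
  · exact h2
  · exact shifted_ball_inter_shifted_ball_subset hpq R ⟨h1, h2⟩

/-- The labelings for which all neighbors of `1` get the same color as `1`. -/
def monochromatic (f : (FreeGroup (Fin k) → X) → κ) : Set (FreeGroup (Fin k) → X) :=
  {x | ∀ p, f (shift p x) = f x}

theorem dependsOn_monochromatic {f : (FreeGroup (Fin k) → X) → κ} {R : ℕ}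
    (hf : DependsOn f (ball k R)) : DependsOn (· ∈ monochromatic f) (ball k (R + 1)) := by
  intro x y h
  have h0 : f x = f y := hf fun g hg => h g (ball_mono (Nat.le_succ R) hg)
  simp only [monochromatic, Set.mem_ofPred_eq, h0, eq_iff_iff]
  refine forall_congr' fun p => ?_
  have h1 : f (shift p x) = f (shift p y) :=
    dependsOn_comp_shift hf p fun g hg => h g (edgeBall_subset_ball p R (Or.inr hg))
  rw [h1]

theorem dependsOn_mem_of_dependsOn {ι β : Type*} {f : (ι → X) → β} {S : Set ι}
    (hf : DependsOn f S) (P : β → Prop) : DependsOn (· ∈ {x | P (f x)}) S := fun x y h => by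
  simp only [Set.mem_ofPred_eq, hf h]

variable [MeasurableSpace X] {ν : Measure X}

/-- The colors that `1` is likely to get, given the labels around the edge in direction `p`. -/
def likelyColors (ν : Measure X) (δ : ℝ) (R : ℕ) (f : (FreeGroup (Fin k) → X) → κ)
    (p : Direction k) (x : FreeGroup (Fin k) → X) : Set κ :=
  {c | δ ≤ condProb ν (edgeBall p R) {y | f y = c} x}

/-- The likely colors of the two endpoints of the edge in direction `p`. -/
def edgeType (ν : Measure X) (δ : ℝ) (R : ℕ) (f : (FreeGroup (Fin k) → X) → κ)
    (p : Direction k) (x : FreeGroup (Fin k) → X) : Set κ × Set κ :=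
  (likelyColors ν δ R f p x, likelyColors ν δ R f p.opp (shift p x))

/-- The types that the edges at `1` are likely to have, given the labels around `1`. -/
def likelyTypes (ν : Measure X) (δ δ' : ℝ) (R : ℕ) (f : (FreeGroup (Fin k) → X) → κ)
    (x : FreeGroup (Fin k) → X) (p : Direction k) : Set (Set κ × Set κ) :=
  {t | δ' ≤ condProb ν (ball k R) {y | edgeType ν δ R f p y = t} x}

theorem dependsOn_likelyColors (δ : ℝ) (R : ℕ) (f : (FreeGroup (Fin k) → X) → κ)
    (p : Direction k) : DependsOn (likelyColors ν δ R f p) (edgeBall p R) := by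
  intro x y h
  ext c
  simp only [likelyColors, Set.mem_ofPred_eq]
  rw [dependsOn_condProb _ _ h]

theorem dependsOn_likelyColors_shift (δ : ℝ) (R : ℕ) (f : (FreeGroup (Fin k) → X) → κ)
    (p : Direction k) :
    DependsOn (fun x => likelyColors ν δ R f p.opp (shift p x)) (edgeBall p R) := fun _ _ h =>
  dependsOn_comp_shift (dependsOn_likelyColors δ R f p.opp) p fun g hg =>
    h g (gen_opp_mul_mem_edgeBall.1 hg)

theorem dependsOn_edgeType (δ : ℝ) (R : ℕ) (f : (FreeGroup (Fin k) → X) → κ)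
    (p : Direction k) : DependsOn (edgeType ν δ R f p) (edgeBall p R) := fun _ _ h =>
  Prod.ext (dependsOn_likelyColors δ R f p h) (dependsOn_likelyColors_shift δ R f p h)

theorem dependsOn_likelyTypes (δ δ' : ℝ) (R : ℕ) (f : (FreeGroup (Fin k) → X) → κ) :
    DependsOn (likelyTypes ν δ δ' R f) (ball k R) := by
  intro x y h
  ext p t
  simp only [likelyTypes, Set.mem_ofPred_eq]
  rw [dependsOn_condProb _ _ h]

theorem edgeType_shift_opp (δ : ℝ) (R : ℕ) (f : (FreeGroup (Fin k) → X) → κ)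
    (p : Direction k) (x : FreeGroup (Fin k) → X) :
    edgeType ν δ R f p (shift p.opp x) = (edgeType ν δ R f p.opp x).swap := by
  simp [edgeType, p.opp_opp]

/-- A tuple of possible types of the edges at `1` that would allow all endpoints to have the same
color. -/
def IsUniformTuple (r : Direction k → Set (Set κ × Set κ)) (t : Direction k → Set κ × Set κ) :
    Prop :=
  ∀ p, t p ∈ r p ∧ t p.opp = (t p).swap

/-- For each dimension, take the edge at `1` in the positive direction. Its type is likely at `1`;
read from the other end, it is likely at the neighbor in the opposite direction, and the neighbor
has the same set of likely types as `1`. -/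
theorem exists_isUniformTuple {δ δ' : ℝ} {R : ℕ} {f : (FreeGroup (Fin k) → X) → κ}
    {x : FreeGroup (Fin k) → X} (hx : x ∈ monochromatic (likelyTypes ν δ δ' R f))
    (h1 : ∀ p, edgeType ν δ R f p x ∈ likelyTypes ν δ δ' R f x p)
    (h2 : ∀ p : Direction k, edgeType ν δ R f p (shift p.opp x) ∈
      likelyTypes ν δ δ' R f (shift p.opp x) p) :
    ∃ t, IsUniformTuple (likelyTypes ν δ δ' R f x) t := by
  have hx' : ∀ p, likelyTypes ν δ δ' R f (shift p x) = likelyTypes ν δ δ' R f x := hx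
  refine ⟨fun p => if p.2 then edgeType ν δ R f p x else (edgeType ν δ R f p.opp x).swap,
    fun p => ⟨?_, ?_⟩⟩
  · dsimp only
    split_ifs
    · exact h1 p
    · rw [← edgeType_shift_opp, ← hx' p.opp]
      exact h2 p
  · rcases p with ⟨d, _ | _⟩ <;> simp [Direction.opp]

variable [IsProbabilityMeasure ν]

theorem measurePreserving_shift (p : Direction k) :
    MeasurePreserving (shift (X := X) p) (Measure.infinitePi fun _ => ν)
      (Measure.infinitePi fun _ => ν) where
  measurable := measurable_pi_lambda _ fun g => measurable_pi_apply _
  map_eq := by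
    classical
    refine Measure.eq_infinitePi _ fun s t ht => ?_
    have hm : Measurable (shift (X := X) p) :=
      measurable_pi_lambda _ fun g => measurable_pi_apply _
    rw [Measure.map_apply hm (.pi s.countable_toSet fun _ _ => ht _)]
    have : shift p ⁻¹' (s : Set (FreeGroup (Fin k))).pi t =
        ((s.map (Equiv.mulLeft (gen p)).toEmbedding : Finset _) : Set (FreeGroup (Fin k))).pi
          fun g => t (gen p.opp * g) := by
      ext x
      simp only [shift, Set.mem_preimage, Set.mem_pi, Finset.mem_coe, Finset.mem_map_equiv,
        Equiv.mulLeft_symm_apply, gen_opp]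
      exact ⟨fun h g hg => by simpa using h _ hg, fun h g hg => by simpa [hg] using h (gen p * g)⟩
    rw [this, Measure.infinitePi_pi _ fun g _ => ht _, Finset.prod_map]
    simp [gen_opp]

theorem condProb_shift (p : Direction k) (S : Set (FreeGroup (Fin k)))
    {E : Set (FreeGroup (Fin k) → X)} (hE : MeasurableSet E) (x : FreeGroup (Fin k) → X) :
    condProb ν S E (shift p x) = condProb ν {g | gen p.opp * g ∈ S} (shift p ⁻¹' E) x := by
  classical
  have hm : MeasurableSet {y | S.piecewise (shift p x) y ∈ E} :=
    (measurable_piecewise_prod S).comp measurable_prodMk_left hE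
  rw [condProb, ← (measurePreserving_shift p).measureReal_preimage hm.nullMeasurableSet, condProb]
  congr 1
  ext y
  simp only [Set.mem_preimage, Set.mem_ofPred_eq]
  convert! Iff.rfl using 2
  ext g
  by_cases hg : g ∈ S <;> simp [shift, hg, gen_opp, Set.piecewise]

variable [DiscreteMeasurableSpace X] [Finite X]

/-- It is unlikely that the color of `1` is likely for all its neighbors. -/
theorem pow_mul_measureReal_forall_mem_likelyColors_le {δ : ℝ} (hδ : 0 ≤ δ) {R : ℕ}
    {f : (FreeGroup (Fin k) → X) → κ} (hf : DependsOn f (ball k (R + 1))) :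
    δ ^ (2 * k) * (Measure.infinitePi fun _ => ν).real
      {x | ∀ p : Direction k, f x ∈ likelyColors ν δ R f p.opp (shift p x)} ≤
      (Measure.infinitePi fun _ => ν).real (monochromatic f) := by
  classical
  refine (mul_measureReal_le_of_le_condProb (S := ball k (R + 1)) (dependsOn_monochromatic hf)
    (finite_ball k _) ?_ (finite_ball k _) (by positivity) fun x hx => ?_).trans
    (measureReal_mono Set.inter_subset_left)
  · intro x y h
    simp only [Set.mem_ofPred_eq, hf h, eq_iff_iff]
    refine forall_congr' fun p => ?_
    have h1 := dependsOn_likelyColors_shift (ν := ν) δ R f p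
      fun g hg => h g (edgeBall_subset_ball p R hg)
    simp only at h1
    rw [h1]
  · have h1 : condProb ν (ball k (R + 1)) (monochromatic f) x =
        condProb ν (ball k (R + 1)) {y | ∀ p, y ∈ {z | f (shift p z) = f x}} x := by
      refine condProb_congr fun y => ?_
      have : f ((ball k (R + 1)).piecewise x y) = f x := hf fun g hg => by simp [hg]
      simp [monochromatic, this]
    -- The views of the neighbors overlap only inside the ball that is conditioned on, so their
    -- colors are conditionally independent.
    rw [h1, condProb_forall_mem_of_disjoint (D := fun p => {g | gen p.opp * g ∈ ball k (R + 1)})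
      (fun p => dependsOn_mem_of_dependsOn (dependsOn_comp_shift hf p) (· = f x))
      (fun p => (finite_edgeBall p (R + 1)).subset fun g => Or.inr)
      fun p q hpq => shifted_ball_inter_shifted_ball_subset hpq (R + 1)]
    calc δ ^ (2 * k) = ∏ p : Direction k, δ := by simp [mul_comm]
      _ ≤ _ := Finset.prod_le_prod (fun _ _ => hδ) fun p _ => (hx p).trans_eq ?_
    have h2 := (dependsOn_mem_of_dependsOn hf (· = f x)).measurableSet_of_finite (finite_ball k _)
    rw [condProb_shift p _ h2]
    -- Conditioning on the ball around `1` tells the neighbor no more than conditioning on the edge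
    -- ball, because its view meets the former only inside the latter.
    refine condProb_congr fun y => ?_
    rw [show {g | gen p.opp * g ∈ edgeBall p.opp R} = edgeBall p R from
      Set.ext fun g => gen_opp_mul_mem_edgeBall]
    have h3 := dependsOn_comp_shift hf p (x := (edgeBall p R).piecewise x y)
      (y := (ball k (R + 1)).piecewise x y) fun g hg => by
        by_cases h4 : g ∈ ball k (R + 1)
        · have := shifted_ball_inter_ball_subset p R ⟨hg, h4⟩
          simp [h4, this]
        · have : g ∉ edgeBall p R := fun h => h4 (edgeBall_subset_ball p R h)
          simp [h4, this]
    simp only at h3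
    exact iff_of_eq (congrArg (· = f x) h3)

/-- Given the ball of radius `R`, the edge types are independent, so a whole uniform tuple is
realized with probability at least `δ' ^ (2 * k)`. Its symmetry turns likely colors of `1` into
likely colors of its neighbors. -/
theorem pow_mul_measureReal_exists_isUniformTuple_le {δ δ' : ℝ} (hδ' : 0 ≤ δ') {R : ℕ}
    {f : (FreeGroup (Fin k) → X) → κ} :
    δ' ^ (2 * k) * (Measure.infinitePi fun _ => ν).real
      {x | ∃ t, IsUniformTuple (likelyTypes ν δ δ' R f x) t} ≤
    (Measure.infinitePi fun _ => ν).real ((⋃ p, {x | f x ∉ likelyColors ν δ R f p x}) ∪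
      {x | ∀ p : Direction k, f x ∈ likelyColors ν δ R f p.opp (shift p x)}) := by
  classical
  -- The tuple is chosen as a function of the likely types alone, so that it is fixed by
  -- conditioning on the ball of radius `R`. The default value is never used.
  let pick : (Direction k → Set (Set κ × Set κ)) → Direction k → Set κ × Set κ := fun r =>
    if h : ∃ t, IsUniformTuple r t then h.choose else fun _ => (∅, ∅)
  have hpick : ∀ r, (∃ t, IsUniformTuple r t) → IsUniformTuple r (pick r) := fun r h => by
    simp only [pick, h, dif_pos]
    exact h.choose_spec
  have hl := dependsOn_likelyTypes (ν := ν) δ δ' R f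
  refine (mul_measureReal_le_of_le_condProb (S := ball k R) (D := ball k (R + 1))
    (E := {x | ∀ p, edgeType ν δ R f p x = pick (likelyTypes ν δ δ' R f x) p})
    ?_ (finite_ball k _) (dependsOn_mem_of_dependsOn hl fun r => ∃ t, IsUniformTuple r t)
    (finite_ball k _) (by positivity) fun x hx => ?_).trans
    (measureReal_mono ?_)
  · intro x y h
    have h1 : likelyTypes ν δ δ' R f x = likelyTypes ν δ δ' R f y :=
      hl fun g hg => h g (ball_mono (Nat.le_succ R) hg)
    have h2 : ∀ p, edgeType ν δ R f p x = edgeType ν δ R f p y := fun p =>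
      dependsOn_edgeType δ R f p fun g hg => h g (edgeBall_subset_ball p R hg)
    simp only [Set.mem_ofPred_eq, h1, h2]
  · have h1 : condProb ν (ball k R)
        {x | ∀ p, edgeType ν δ R f p x = pick (likelyTypes ν δ δ' R f x) p} x =
        condProb ν (ball k R)
          {y | ∀ p, y ∈ {z | edgeType ν δ R f p z = pick (likelyTypes ν δ δ' R f x) p}} x := by
      refine condProb_congr fun y => ?_
      have : likelyTypes ν δ δ' R f ((ball k R).piecewise x y) = likelyTypes ν δ δ' R f x :=
        hl fun g hg => by simp [hg]
      simp [this]
    rw [h1, condProb_forall_mem_of_disjoint (D := fun p => edgeBall p R)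
      (fun p => dependsOn_mem_of_dependsOn (dependsOn_edgeType δ R f p)
        (· = pick (likelyTypes ν δ δ' R f x) p))
      (fun p => finite_edgeBall p R) fun p q hpq => edgeBall_inter_edgeBall_subset hpq R]
    calc δ' ^ (2 * k) = ∏ p : Direction k, δ' := by simp [mul_comm]
      _ ≤ _ := Finset.prod_le_prod (fun _ _ => hδ') fun p _ => (hpick _ hx p).1
  · rintro x ⟨hx, hx'⟩
    have ht := hpick _ hx'
    set t := pick (likelyTypes ν δ δ' R f x)
    simp only [Set.mem_ofPred_eq] at hx
    by_cases hc : ∀ p, f x ∈ likelyColors ν δ R f p x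
    · refine Or.inr fun p => ?_
      -- The neighbor's likely colors on the edge `p` are the second half of `t p`, hence the first
      -- half of `t p.opp`, which are the likely colors of `1` on the opposite edge.
      have h1 : likelyColors ν δ R f p.opp (shift p x) = (t p).2 := congrArg Prod.snd (hx p)
      have h2 : likelyColors ν δ R f p.opp x = (t p.opp).1 := congrArg Prod.fst (hx p.opp)
      rw [h1, ← Prod.fst_swap, ← (ht p).2, ← h2]
      exact hc p.opp
    · obtain ⟨p, hp⟩ := not_forall.1 hc
      exact Or.inl (Set.mem_iUnion.2 ⟨p, hp⟩)

variable [Fintype κ]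

theorem measureReal_notMem_likelyColors_le {δ : ℝ} (hδ : 0 ≤ δ) {R : ℕ}
    {f : (FreeGroup (Fin k) → X) → κ} (hf : DependsOn f (ball k (R + 1))) (p : Direction k) :
    (Measure.infinitePi fun _ => ν).real {x | f x ∉ likelyColors ν δ R f p x} ≤
      Fintype.card κ * δ := by
  have h : {x | f x ∉ likelyColors ν δ R f p x} ⊆
      ⋃ c, {x | x ∈ {y | f y = c} ∧ ¬ δ ≤ condProb ν (edgeBall p R) {y | f y = c} x} := fun x hx =>
    Set.mem_iUnion.2 ⟨f x, rfl, hx⟩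
  refine (measureReal_mono h).trans ((measureReal_iUnion_fintype_le _).trans ?_)
  refine (Finset.sum_le_card_nsmul _ _ δ fun c _ => ?_).trans_eq (by simp)
  exact measureReal_inter_condProb_lt_le (dependsOn_mem_of_dependsOn hf (· = c))
    (finite_ball k _) (finite_edgeBall p R) hδ

/-- A union bound over all types; the factor `4 ^ Fintype.card κ` is the number of pairs of color
sets. -/
theorem measureReal_edgeType_notMem_likelyTypes_le (δ : ℝ) {δ' : ℝ} (hδ' : 0 ≤ δ') (R : ℕ)
    (f : (FreeGroup (Fin k) → X) → κ) (p : Direction k) :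
    (Measure.infinitePi fun _ => ν).real
      {x | edgeType ν δ R f p x ∉ likelyTypes ν δ δ' R f x p} ≤ 4 ^ Fintype.card κ * δ' := by
  classical
  have h : {x | edgeType ν δ R f p x ∉ likelyTypes ν δ δ' R f x p} ⊆
      ⋃ t, {x | x ∈ {y | edgeType ν δ R f p y = t} ∧
        ¬ δ' ≤ condProb ν (ball k R) {y | edgeType ν δ R f p y = t} x} := fun x hx =>
    Set.mem_iUnion.2 ⟨_, rfl, hx⟩
  refine (measureReal_mono h).trans ((measureReal_iUnion_fintype_le _).trans ?_)
  refine (Finset.sum_le_card_nsmul _ _ δ' fun t _ => ?_).trans_eq ?_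
  · exact measureReal_inter_condProb_lt_le
      (dependsOn_mem_of_dependsOn (dependsOn_edgeType δ R f p) (· = t))
      (finite_edgeBall p R) (finite_ball k R) hδ'
  · simp [← mul_pow]

/-- If a coloring with radius `R + 1` is rarely monochromatic at `1`, then so is the coloring by
`likelyTypes`, which has radius `R`. -/
theorem measureReal_monochromatic_likelyTypes_le {δ δ' : ℝ} (hδ : 0 < δ) (hδ' : 0 < δ') {R : ℕ}
    {f : (FreeGroup (Fin k) → X) → κ} (hf : DependsOn f (ball k (R + 1))) :
    (Measure.infinitePi fun _ => ν).real (monochromatic (likelyTypes ν δ δ' R f)) ≤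
      4 * k * 4 ^ Fintype.card κ * δ' + (2 * k * Fintype.card κ * δ +
        (Measure.infinitePi fun _ => ν).real (monochromatic f) / δ ^ (2 * k)) / δ' ^ (2 * k) := by
  have hsub : monochromatic (likelyTypes ν δ δ' R f) ⊆
      ((⋃ p, {x | edgeType ν δ R f p x ∉ likelyTypes ν δ δ' R f x p}) ∪
        ⋃ p : Direction k, shift p.opp ⁻¹'
          {x | edgeType ν δ R f p x ∉ likelyTypes ν δ δ' R f x p}) ∪
      {x | ∃ t, IsUniformTuple (likelyTypes ν δ δ' R f x) t} := by
    intro x hx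
    by_contra! h
    simp only [Set.mem_union, Set.mem_iUnion, not_or, not_exists, Set.mem_preimage,
      Set.mem_ofPred_eq, not_not] at h
    obtain ⟨t, ht⟩ := exists_isUniformTuple hx h.1.1 h.1.2
    exact h.2 t ht
  have hE := fun p => measureReal_edgeType_notMem_likelyTypes_le (ν := ν) δ hδ'.le R f p
  have hEm : ∀ p, MeasurableSet {x | edgeType ν δ R f p x ∉ likelyTypes ν δ δ' R f x p} := fun p =>
    DependsOn.measurableSet_of_finite (S := edgeBall p R) (fun x y h => by
      have h1 : likelyTypes ν δ δ' R f x = likelyTypes ν δ δ' R f y :=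
        dependsOn_likelyTypes δ δ' R f fun g hg => h g (ball_subset_edgeBall p R hg)
      have h2 : edgeType ν δ R f p x = edgeType ν δ R f p y := dependsOn_edgeType δ R f p h
      simp only [Set.mem_ofPred_eq, h1, h2]) (finite_edgeBall p R)
  have h1 : (Measure.infinitePi fun _ => ν).real
      (⋃ p, {x | edgeType ν δ R f p x ∉ likelyTypes ν δ δ' R f x p}) ≤
      2 * k * (4 ^ Fintype.card κ * δ') := by
    refine (measureReal_iUnion_fintype_le _).trans ?_
    refine (Finset.sum_le_card_nsmul _ _ _ fun p _ => hE p).trans_eq ?_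
    simp [mul_comm]
  have h2 : (Measure.infinitePi fun _ => ν).real (⋃ p : Direction k, shift p.opp ⁻¹'
      {x | edgeType ν δ R f p x ∉ likelyTypes ν δ δ' R f x p}) ≤
      2 * k * (4 ^ Fintype.card κ * δ') := by
    refine (measureReal_iUnion_fintype_le _).trans ?_
    refine (Finset.sum_le_card_nsmul _ _ (4 ^ Fintype.card κ * δ') fun p _ => ?_).trans_eq
      (by simp [mul_comm])
    rw [(measurePreserving_shift _).measureReal_preimage (hEm p).nullMeasurableSet]
    exact hE p
  have h3 : (Measure.infinitePi fun _ => ν).real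
      (⋃ p, {x | f x ∉ likelyColors ν δ R f p x}) ≤ 2 * k * (Fintype.card κ * δ) := by
    refine (measureReal_iUnion_fintype_le _).trans ?_
    refine (Finset.sum_le_card_nsmul _ _ _ fun p _ =>
      measureReal_notMem_likelyColors_le hδ.le hf p).trans_eq ?_
    simp [mul_comm]
  have h4 := pow_mul_measureReal_forall_mem_likelyColors_le (ν := ν) hδ.le hf
  have h5 := pow_mul_measureReal_exists_isUniformTuple_le (ν := ν) (δ := δ) (R := R) (f := f) hδ'.le
  rw [← le_div_iff₀' (by positivity)] at h4 h5
  calc _ ≤ _ := (measureReal_mono hsub).trans (measureReal_union_le _ _)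
    _ ≤ (2 * k * (4 ^ Fintype.card κ * δ') + 2 * k * (4 ^ Fintype.card κ * δ')) +
        (2 * k * (Fintype.card κ * δ) +
          (Measure.infinitePi fun _ => ν).real (monochromatic f) / δ ^ (2 * k)) / δ' ^ (2 * k) := by
      refine add_le_add ((measureReal_union_le _ _).trans (add_le_add h1 h2)) (h5.trans ?_)
      gcongr
      exact (measureReal_union_le _ _).trans (add_le_add h3 h4)
    _ = _ := by ring

end FreeGroup

/-! ### Iterated exponentials -/

/-- The `i`-fold iterated exponential (to base `2`) of `y`. -/
def iteratedExp (i y : ℕ) : ℕ := (fun m => 2 ^ m)^[i] y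

theorem iteratedExp_zero (y : ℕ) : iteratedExp 0 y = y := rfl

theorem iteratedExp_succ (i y : ℕ) : iteratedExp (i + 1) y = 2 ^ iteratedExp i y :=
  Function.iterate_succ_apply' _ _ _

theorem iteratedExp_add (i j y : ℕ) : iteratedExp (i + j) y = iteratedExp i (iteratedExp j y) :=
  Function.iterate_add_apply _ _ _ _

theorem le_iteratedExp (i y : ℕ) : y ≤ iteratedExp i y := by
  induction i with
  | zero => exact le_rfl
  | succ i ih =>
    rw [iteratedExp_succ]
    exact ih.trans Nat.lt_two_pow_self.le

theorem iteratedExp_mono {i y z : ℕ} (h : y ≤ z) : iteratedExp i y ≤ iteratedExp i z := by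
  induction i with
  | zero => exact h
  | succ i ih =>
    rw [iteratedExp_succ, iteratedExp_succ]
    exact Nat.pow_le_pow_right two_pos ih

theorem iteratedExp_mono_left {i j : ℕ} (h : i ≤ j) (y : ℕ) :
    iteratedExp i y ≤ iteratedExp j y := by
  obtain ⟨d, rfl⟩ := Nat.exists_eq_add_of_le' h
  rw [iteratedExp_add]
  exact le_iteratedExp _ _

theorem two_mul_le_two_pow (n : ℕ) : 2 * n ≤ 2 ^ n := by
  rcases n with _ | n
  · simp
  · rw [pow_succ']
    exact Nat.mul_le_mul_left 2 Nat.lt_two_pow_self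

theorem mul_self_le_two_pow {n : ℕ} (hn : 4 ≤ n) : n * n ≤ 2 ^ n := by
  induction n, hn using Nat.le_induction with
  | base => norm_num
  | succ n hn ih =>
    rw [pow_succ]
    nlinarith

theorem mul_four_pow_le {a B c : ℕ} (ha : a ≤ 2 ^ B) : a * 4 ^ c ≤ 2 ^ 2 ^ (c + B) := by
  calc a * 4 ^ c ≤ 2 ^ B * 4 ^ c := Nat.mul_le_mul_right _ ha
    _ ≤ 2 ^ (2 * (c + B)) := by
      rw [show (4 : ℕ) = 2 ^ 2 by norm_num, ← pow_mul, ← pow_add]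
      exact Nat.pow_le_pow_right two_pos (by omega)
    _ ≤ _ := Nat.pow_le_pow_right two_pos (two_mul_le_two_pow _)

/-- With `a = 2 * k`, the power is the number of colors after one elimination step. Keeping the
summand `B` on the left lets the bound be iterated. -/
theorem pow_mul_four_pow_add_le {a B c : ℕ} (ha : a ≤ B) :
    2 ^ (a * 4 ^ c) + B ≤ iteratedExp 3 (c + B) := by
  have h1 : a * 4 ^ c + B ≤ 2 ^ 2 ^ (c + B) := by
    refine le_trans ?_ (mul_four_pow_le (a := 2 * B) (two_mul_le_two_pow B))
    have : 1 ≤ 4 ^ c := Nat.one_le_pow _ _ (by norm_num)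
    nlinarith
  have h2 : B + 1 ≤ 2 ^ B := Nat.lt_two_pow_self
  have h3 : 1 ≤ 2 ^ (a * 4 ^ c) := Nat.one_le_pow _ _ (by norm_num)
  calc 2 ^ (a * 4 ^ c) + B ≤ 2 ^ (a * 4 ^ c) * 2 ^ B := by nlinarith
    _ = 2 ^ (a * 4 ^ c + B) := (pow_add _ _ _).symm
    _ ≤ _ := Nat.pow_le_pow_right two_pos h1

theorem pow_le_iteratedExp_two {W m : ℕ} (hm : m ≤ W) (hW : 4 ≤ W) :
    W ^ m ≤ iteratedExp 2 W := by
  calc W ^ m ≤ (2 ^ W) ^ m := Nat.pow_le_pow_left Nat.lt_two_pow_self.le m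
    _ = 2 ^ (W * m) := (pow_mul _ _ _).symm
    _ ≤ 2 ^ 2 ^ W := Nat.pow_le_pow_right two_pos
      ((Nat.mul_le_mul_left W hm).trans (mul_self_le_two_pow hW))

/-! ### Lower bound on the probability of a monochromatic neighborhood -/

namespace FreeGroup

variable {k : ℕ} {X : Type*} [MeasurableSpace X] {ν : Measure X} [IsProbabilityMeasure ν]
  [DiscreteMeasurableSpace X]

/-- At radius `0` the color of a node is a function of its own label. Some color has probability at
least `1 / Fintype.card κ`, and the `2 * k + 1` labels at `1` and its neighbors are independent. -/
theorem inv_pow_le_measureReal_monochromatic {κ : Type*} [Fintype κ]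
    {f : (FreeGroup (Fin k) → X) → κ} (hf : DependsOn f (ball k 0)) :
    (1 / (Fintype.card κ : ℝ)) ^ (2 * k + 1) ≤
      (Measure.infinitePi fun _ => ν).real (monochromatic f) := by
  classical
  obtain ⟨x₀⟩ : Nonempty X := nonempty_of_isProbabilityMeasure ν
  have hf' : ∀ x, f x = f fun _ => x 1 := fun x => hf fun g hg => by
    rw [ball_zero] at hg
    rw [hg]
  obtain ⟨c, hc⟩ : ∃ c, 1 / (Fintype.card κ : ℝ) ≤ ν.real {a | f (fun _ => a) = c} := by
    by_contra! h
    have h1 : ν.real (⋃ c, {a | f (fun _ => a) = c}) = 1 := by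
      rw [show (⋃ c, {a | f (fun _ => a) = c}) = Set.univ by ext; simp, probReal_univ]
    have h2 : (1 : ℝ) < ∑ _ : κ, 1 / (Fintype.card κ : ℝ) := by
      refine h1.symm.trans_lt ((measureReal_iUnion_fintype_le _).trans_lt
        (Finset.sum_lt_sum_of_nonempty ⟨f fun _ => x₀, Finset.mem_univ _⟩ fun c _ => h c))
    have : Fintype.card κ ≠ 0 := (Fintype.card_pos_iff.2 ⟨f fun _ => x₀⟩).ne'
    simp [this] at h2
  have hsub : ((insert 1 (Finset.univ.image gen) : Finset (FreeGroup (Fin k))) :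
      Set (FreeGroup (Fin k))).pi (fun _ => {a | f (fun _ => a) = c}) ⊆ monochromatic f := by
    intro x hx p
    simp only [Finset.coe_insert, Finset.coe_image, Finset.coe_univ, Set.image_univ, Set.mem_pi,
      Set.mem_insert_iff, Set.mem_range, Set.mem_ofPred_eq, forall_eq_or_imp,
      forall_exists_index, forall_apply_eq_imp_iff] at hx
    rw [hf' x, hf' (shift p x), hx.1]
    simpa [shift] using hx.2 p
  refine le_trans ?_ (measureReal_mono hsub)
  rw [Measure.real, Measure.infinitePi_pi _ fun _ _ => MeasurableSet.of_discrete,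
    Finset.prod_const, ENNReal.toReal_pow, Finset.card_insert_of_notMem,
    Finset.card_image_of_injective _ gen_injective, Finset.card_univ]
  · simp only [Fintype.card_prod, Fintype.card_fin, Fintype.card_bool]
    rw [mul_comm k 2]
    exact pow_le_pow_left₀ (by positivity) hc _
  · simp only [Finset.mem_image, Finset.mem_univ, true_and, not_exists]
    exact fun p hp => gen_mul_ne p 1 (by rw [mul_one, hp])

variable [Finite X]

theorem inv_pow_le_of_inv_le {κ : Type*} [Fintype κ] (hk : 1 ≤ k) {R Y : ℕ} (hY : 0 < Y)
    {f : (FreeGroup (Fin k) → X) → κ} (hf : DependsOn f (ball k (R + 1)))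
    (h : ∀ δ δ' : ℝ, 1 / (Y : ℝ) ≤
      (Measure.infinitePi fun _ => ν).real (monochromatic (likelyTypes ν δ δ' R f))) :
    1 / (((8 * k * 4 ^ Fintype.card κ * Y) ^ (2 * k + 1) ^ 2 : ℕ) : ℝ) ≤
      (Measure.infinitePi fun _ => ν).real (monochromatic f) := by
  set c := Fintype.card κ
  set P := (Measure.infinitePi fun _ => ν).real (monochromatic f)
  by_contra! hP
  have hkR : (1 : ℝ) ≤ k := by exact_mod_cast hk
  have hYR : (0 : ℝ) < Y := by exact_mod_cast hY
  set Z : ℝ := 8 * k * 4 ^ c * Y with hZ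
  have hZ0 : 0 < Z := by positivity
  set η : ℝ := 1 / Z with hη
  have hη0 : 0 < η := by positivity
  have hP' : P < η ^ (2 * k + 1) ^ 2 := by
    rw [hη, one_div_pow]
    push_cast at hP
    exact hP
  -- Taking `δ' = η` and `δ = η ^ (2 * k + 1)` makes every error term a multiple of `η`, even after
  -- division by `δ' ^ (2 * k)`; `Z` is chosen so that they sum to less than `1 / Y`.
  have h1 := (h (η ^ (2 * k + 1)) η).trans
    (measureReal_monochromatic_likelyTypes_le (pow_pos hη0 _) hη0 hf)
  have h2 : P / (η ^ (2 * k + 1)) ^ (2 * k) < η ^ (2 * k + 1) := by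
    rw [div_lt_iff₀ (by positivity), ← pow_mul, ← pow_add,
      show 2 * k + 1 + (2 * k + 1) * (2 * k) = (2 * k + 1) ^ 2 by ring]
    exact hP'
  have h3 : (2 * k * c * η ^ (2 * k + 1) + P / (η ^ (2 * k + 1)) ^ (2 * k)) / η ^ (2 * k) <
      (2 * k * c + 1) * η := by
    rw [div_lt_iff₀ (by positivity)]
    calc _ < 2 * k * c * η ^ (2 * k + 1) + η ^ (2 * k + 1) := by gcongr
      _ = _ := by ring
  have h4 : (c : ℝ) + 1 ≤ 4 ^ c := by
    have : c + 1 ≤ 4 ^ c := Nat.lt_pow_self (by norm_num)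
    exact_mod_cast this
  have h5 : (4 * k * 4 ^ c + (2 * k * c + 1)) * η ≤ 1 / Y := by
    calc (4 * k * 4 ^ c + (2 * k * c + 1)) * η ≤ (8 * k * 4 ^ c) * η := by
          gcongr
          nlinarith
      _ = 1 / Y := by
        rw [hη, hZ]
        field_simp
  linarith

/-- Each round costs five exponentials: three for the larger number of colors and two for the power
in `inv_pow_le_of_inv_le`. The base case takes the other two. -/
theorem inv_iteratedExp_le_measureReal_monochromatic (hk : 1 ≤ k) (R : ℕ) {κ : Type*} [Fintype κ]
    {f : (FreeGroup (Fin k) → X) → κ} (hf : DependsOn f (ball k R)) :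
    1 / (iteratedExp (5 * R + 2) (Fintype.card κ + 2 * (2 * k + 1) ^ 2) : ℝ) ≤
      (Measure.infinitePi fun _ => ν).real (monochromatic f) := by
  induction R generalizing κ with
  | zero =>
    refine le_trans ?_ (inv_pow_le_measureReal_monochromatic hf)
    obtain ⟨x₀⟩ : Nonempty X := nonempty_of_isProbabilityMeasure ν
    have hc : 0 < Fintype.card κ := Fintype.card_pos_iff.2 ⟨f fun _ => x₀⟩
    rw [one_div_pow]
    refine one_div_le_one_div_of_le (by positivity) ?_
    norm_cast
    exact (Nat.pow_le_pow_left (by omega) _).trans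
      (pow_le_iteratedExp_two (by nlinarith) (by nlinarith))
  | succ R ih =>
    classical
    set c := Fintype.card κ with hc
    set B := 2 * (2 * k + 1) ^ 2 with hB
    set Y := iteratedExp (5 * R + 2) (Fintype.card (Direction k → Set (Set κ × Set κ)) + B) with hY
    have hY0 : 0 < Y := lt_of_lt_of_le (by positivity) (le_iteratedExp _ _)
    refine le_trans ?_ (inv_pow_le_of_inv_le hk hY0 hf fun δ δ' =>
      ih (dependsOn_likelyTypes δ δ' R f))
    refine one_div_le_one_div_of_le (by positivity) (Nat.cast_le.2 ?_)
    set W := iteratedExp (5 * R + 5) (c + B) with hW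
    have hYW : Y ≤ W := by
      rw [hW, show 5 * R + 5 = (5 * R + 2) + 3 by ring, iteratedExp_add]
      refine iteratedExp_mono ?_
      convert! pow_mul_four_pow_add_le (a := 2 * k) (B := B) (c := c) (by nlinarith) using 2
      simp only [Fintype.card_pi, Fintype.card_set, Fintype.card_prod, Finset.prod_const,
        Finset.card_univ, Fintype.card_fin, Fintype.card_bool]
      rw [← pow_mul, ← mul_pow]
      norm_num [hc]
      ring
    have hkW : 8 * k * 4 ^ c ≤ W := by
      refine (mul_four_pow_le (B := B) ?_).trans (iteratedExp_mono_left (i := 2) (by omega) _)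
      exact le_trans (by nlinarith) Nat.lt_two_pow_self.le
    have hBW : B ≤ W := le_trans (by omega) (le_iteratedExp _ _)
    calc (8 * k * 4 ^ c * Y) ^ (2 * k + 1) ^ 2 ≤ (W * W) ^ (2 * k + 1) ^ 2 :=
          Nat.pow_le_pow_left (Nat.mul_le_mul hkW hYW) _
      _ = W ^ B := by rw [← sq, ← pow_mul]
      _ ≤ iteratedExp 2 W := pow_le_iteratedExp_two hBW (by nlinarith)
      _ = _ := by rw [hW, ← iteratedExp_add]; congr 1; ring

end FreeGroup

/-! ### Finite regular trees inside the Cayley graph -/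

/-- Handshaking: the degrees sum to `n` plus `2 * k - 1` for every inner node, and also to `2 * (n -
1)`. -/
theorem IsRegularTree.card_eq {k n : ℕ} (hk : 1 ≤ k) {G : SimpleGraph (Fin n)}
    (hG : IsRegularTree (2 * k) G) :
    n = (2 * k - 1) * {v | (G.neighborSet v).ncard = 2 * k}.ncard + 2 := by
  classical
  have hdeg : ∀ v, (G.neighborSet v).ncard = G.degree v := fun v => by
    rw [Set.ncard_eq_toFinset_card', ← SimpleGraph.neighborFinset, SimpleGraph.card_neighborFinset_eq_degree]
  have h1 := G.sum_degrees_eq_twice_card_edges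
  have h2 := hG.1.card_edgeFinset
  rw [Fintype.card_fin] at h2
  have h3 : ∑ v, G.degree v = ∑ v, (1 + if (G.neighborSet v).ncard = 2 * k then 2 * k - 1 else 0) :=
    Finset.sum_congr rfl fun v _ => by
      rw [← hdeg]
      rcases hG.2 v with h | h
      · rw [if_pos h, h]; omega
      · rw [h, if_neg (by omega)]
  rw [Finset.sum_add_distrib, ← Finset.sum_filter, Finset.sum_const, Finset.sum_const,
    Finset.card_univ, Fintype.card_fin, smul_eq_mul, smul_eq_mul, mul_one] at h3
  rw [Set.ncard_eq_toFinset_card', Set.toFinset_ofPred, mul_comm]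
  omega

namespace FreeGroup

variable {k m : ℕ}

/-- The element that is obtained by deleting the first letter of the reduced word. -/
def parent (g : FreeGroup (Fin k)) : FreeGroup (Fin k) := mk g.toWord.tail

@[simp]
theorem parent_one : parent (1 : FreeGroup (Fin k)) = 1 := by simp [parent, one_eq_mk]

theorem parent_gen_mul {p : Direction k} {g : FreeGroup (Fin k)}
    (h : (gen p * g).norm = g.norm + 1) : parent (gen p * g) = g := by
  rcases toWord_gen_mul p g with h' | h'
  · rw [parent, h', List.tail_cons, mk_toWord]
  · have := congrArg List.length h'
    simp only [List.length_cons] at this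
    unfold norm at h
    omega

theorem exists_eq_gen_mul_parent {g : FreeGroup (Fin k)} (hg : g ≠ 1) :
    ∃ p, g = gen p * parent g ∧ g.norm = (parent g).norm + 1 := by
  obtain ⟨p, w, rfl, h⟩ := exists_gen_mul_of_ne_one hg
  exact ⟨p, by rw [parent_gen_mul h], by rw [parent_gen_mul h, h]⟩

theorem norm_parent_le (g : FreeGroup (Fin k)) : (parent g).norm ≤ g.norm := by
  by_cases hg : g = 1
  · simp [hg]
  · obtain ⟨p, -, h⟩ := exists_eq_gen_mul_parent hg
    omega

theorem parent_gen_mul_eq_or (p : Direction k) (g : FreeGroup (Fin k)) :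
    parent (gen p * g) = g ∨ gen p * g = parent g ∧ g.norm = (gen p * g).norm + 1 := by
  rcases norm_gen_mul p g with h | h
  · exact Or.inl (parent_gen_mul h)
  · right
    have h' : g = gen p.opp * (gen p * g) := by simp [gen_opp]
    have := parent_gen_mul (p := p.opp) (g := gen p * g) (by rw [← h', h])
    rw [← h'] at this
    exact ⟨this.symm, h⟩

/-- A numbering of the nodes of a finite subtree of the Cayley graph of the free group. The subtree
consists of the nodes in `core`, which have all their neighbors in the subtree, and of leaves. -/
structure SubtreeNumbering (k m : ℕ) where
  core : Set (FreeGroup (Fin k))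
  one_mem : 1 ∈ core
  parent_mem : ∀ g ∈ core, parent g ∈ core
  toFun : Fin m → FreeGroup (Fin k)
  injective : Function.Injective toFun
  mem_range_iff : ∀ g, g ∈ Set.range toFun ↔ parent g ∈ core

namespace SubtreeNumbering

variable (e : SubtreeNumbering k m)

theorem exists_toFun_eq_gen_mul {u : Fin m} (hu : e.toFun u ∈ e.core) (p : Direction k) :
    ∃ v, e.toFun v = gen p * e.toFun u := by
  refine (e.mem_range_iff _).2 ?_
  rcases parent_gen_mul_eq_or p (e.toFun u) with h | h
  · rwa [h]
  · rw [h.1]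
    exact e.parent_mem _ (e.parent_mem _ hu)

theorem parent_toFun_mem (u : Fin m) : parent (e.toFun u) ∈ e.core :=
  (e.mem_range_iff _).1 ⟨u, rfl⟩

theorem exists_toFun_eq_parent (u : Fin m) : ∃ v, e.toFun v = parent (e.toFun u) :=
  (e.mem_range_iff _).2 (e.parent_mem _ (e.parent_toFun_mem u))

/-- The Cayley graph on the nodes of the subtree. -/
def graph : SimpleGraph (Fin m) where
  Adj u v := ∃ p, e.toFun v = gen p * e.toFun u
  symm.symm := by
    rintro u v ⟨p, hp⟩
    exact ⟨p.opp, by simp [hp, gen_opp]⟩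
  loopless.irrefl := by
    rintro u ⟨p, hp⟩
    exact gen_mul_ne p _ hp.symm

theorem graph_adj {u v : Fin m} : e.graph.Adj u v ↔ ∃ p, e.toFun v = gen p * e.toFun u := Iff.rfl

open Classical in
/-- The neighbor of the node `u` in direction `p`, if there is one. -/
noncomputable def nbr (u : Fin m) (p : Direction k) : Option (Fin m) :=
  if h : ∃ v, e.toFun v = gen p.opp * e.toFun u then some h.choose else none

theorem nbr_eq_some {u v : Fin m} {p : Direction k} :
    e.nbr u p = some v ↔ e.toFun v = gen p.opp * e.toFun u := by
  unfold nbr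
  split_ifs with h
  · rw [Option.some_inj]
    exact ⟨fun h' => h' ▸ h.choose_spec, fun h' => e.injective (h.choose_spec.trans h'.symm)⟩
  · exact ⟨fun h' => (by cases h'), fun h' => absurd ⟨v, h'⟩ h⟩

/-- The directions in the Cayley graph. -/
noncomputable def orientation : ConsistentOrientation k e.graph where
  nbr := e.nbr
  adj_iff u v := by
    simp only [nbr_eq_some, graph_adj]
    exact ⟨fun ⟨p, hp⟩ => ⟨p.opp, by rwa [p.opp_opp]⟩, fun ⟨p, hp⟩ => ⟨p.opp, hp⟩⟩
  unique u v p q hp hq := by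
    rw [nbr_eq_some] at hp hq
    have := gen_injective (mul_right_cancel (hp.symm.trans hq))
    rw [← p.opp_opp, this, q.opp_opp]
  consistent u v p hp := by
    rw [nbr_eq_some] at hp ⊢
    rw [hp, gen_opp, gen_opp, inv_inv, mul_inv_cancel_left]

theorem exists_adj_toFun_eq_parent {u : Fin m} (hu : e.toFun u ≠ 1) :
    ∃ v, e.graph.Adj u v ∧ e.toFun v = parent (e.toFun u) ∧
      (e.toFun u).norm = (e.toFun v).norm + 1 := by
  obtain ⟨v, hv⟩ := e.exists_toFun_eq_parent u
  obtain ⟨p, hp, hn⟩ := exists_eq_gen_mul_parent hu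
  exact ⟨v, (e.graph_adj.2 ⟨p, by rw [hv]; exact hp⟩).symm, hv, by rw [hv]; exact hn⟩

theorem toFun_eq_parent_or {u v : Fin m} (h : e.graph.Adj u v) :
    e.toFun u = parent (e.toFun v) ∧ e.toFun v ≠ 1 ∨
      e.toFun v = parent (e.toFun u) ∧ e.toFun u ≠ 1 := by
  obtain ⟨p, hp⟩ := h
  have key := norm_gen_mul p (e.toFun u)
  rcases parent_gen_mul_eq_or p (e.toFun u) with h | h
  · by_cases hv : e.toFun v = 1
    · right
      rw [← hp, hv, parent_one] at h
      rw [← hp, hv, ← h] at key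
      simp at key
    · exact Or.inl ⟨by rw [hp, h], hv⟩
  · refine Or.inr ⟨hp.trans h.1, fun h1 => ?_⟩
    rw [h1, norm_one] at h
    omega

theorem graph_connected : e.graph.Connected := by
  obtain ⟨r, hr⟩ := (e.mem_range_iff 1).2 (by simpa using e.one_mem)
  have key : ∀ n u, (e.toFun u).norm = n → e.graph.Reachable u r := by
    intro n
    induction n with
    | zero =>
      intro u hu
      rw [norm_eq_zero, ← hr] at hu
      rw [e.injective hu]
    | succ n ih =>
      intro u hu
      obtain ⟨v, hv, -, hn⟩ := e.exists_adj_toFun_eq_parent (u := u) fun h => by simp [h] at hu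
      exact hv.reachable.trans (ih v (by omega))
  have : Nonempty (Fin m) := ⟨r⟩
  exact ⟨fun u v => (key _ u rfl).trans (key _ v rfl).symm⟩

/-- Every edge joins a non-root node to its parent, so a connected graph on `m` nodes has at most `m
- 1` edges here. -/
theorem graph_isTree : e.graph.IsTree := by
  classical
  refine SimpleGraph.isTree_iff_connected_and_card.2 ⟨e.graph_connected, le_antisymm ?_
    e.graph_connected.card_vert_le_card_edgeSet_add_one⟩
  obtain ⟨r, hr⟩ := (e.mem_range_iff 1).2 (by simpa using e.one_mem)
  choose par hpar using e.exists_toFun_eq_parent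
  have hsub : e.graph.edgeSet ⊆ (fun v => s(v, par v)) '' {v | v ≠ r} := by
    intro x
    induction x with
    | _ u v =>
      intro h
      rw [SimpleGraph.mem_edgeSet] at h
      rcases e.toFun_eq_parent_or h with ⟨h, h1⟩ | ⟨h, h1⟩
      · exact ⟨v, fun hv => h1 (hv ▸ hr), by
          rw [e.injective (h.trans (hpar v).symm)]; exact Sym2.eq_swap⟩
      · exact ⟨u, fun hu => h1 (hu ▸ hr), by rw [e.injective (h.trans (hpar u).symm)]⟩
  rw [Nat.card_coe_set_eq, Nat.card_fin]
  have h1 := (Set.ncard_le_ncard hsub).trans (Set.ncard_image_le (Set.toFinite _))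
  have h2 : ({v | v ≠ r} : Set (Fin m)).ncard + 1 = m := by
    have := Set.ncard_add_ncard_compl {r}
    rw [Set.ncard_singleton, Nat.card_fin] at this
    rw [add_comm]
    exact this
  omega

theorem ncard_neighborSet_of_mem_core {u : Fin m} (hu : e.toFun u ∈ e.core) :
    (e.graph.neighborSet u).ncard = 2 * k := by
  choose w hw using e.exists_toFun_eq_gen_mul hu
  have : e.graph.neighborSet u = Set.range w := by
    ext v
    rw [SimpleGraph.mem_neighborSet, graph_adj]
    exact ⟨fun ⟨p, hp⟩ => ⟨p, e.injective ((hw p).trans hp.symm)⟩, by rintro ⟨p, rfl⟩; exact ⟨p, hw p⟩⟩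
  have hinj : Function.Injective w := fun p q hpq =>
    gen_injective (mul_right_cancel ((hw p).symm.trans (hpq ▸ hw q)))
  rw [this, ← Set.image_univ, Set.ncard_image_of_injective _ hinj, Set.ncard_univ]
  simp [mul_comm]

theorem ncard_neighborSet_of_notMem_core {u : Fin m} (hu : e.toFun u ∉ e.core) :
    (e.graph.neighborSet u).ncard = 1 := by
  obtain ⟨v, hv, hp, -⟩ := e.exists_adj_toFun_eq_parent fun h => hu (h ▸ e.one_mem)
  rw [Set.ncard_eq_one]
  refine ⟨v, Set.eq_singleton_iff_unique_mem.2 ⟨hv, fun w hw => ?_⟩⟩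
  rcases e.toFun_eq_parent_or hw with h | h
  · exact absurd (h.1 ▸ e.parent_toFun_mem w) hu
  · exact e.injective (h.1.trans hp.symm)

theorem graph_isRegularTree : IsRegularTree (2 * k) e.graph :=
  ⟨e.graph_isTree, fun u => by
    by_cases hu : e.toFun u ∈ e.core
    · exact Or.inl (e.ncard_neighborSet_of_mem_core hu)
    · exact Or.inr (e.ncard_neighborSet_of_notMem_core hu)⟩

theorem card_eq (hk : 1 ≤ k) : m = (2 * k - 1) * e.core.ncard + 2 := by
  have h := e.graph_isRegularTree.card_eq hk
  have : e.core = e.toFun '' {u | (e.graph.neighborSet u).ncard = 2 * k} := by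
    ext g
    constructor
    · intro hg
      obtain ⟨u, rfl⟩ := (e.mem_range_iff g).2 (e.parent_mem g hg)
      exact ⟨u, e.ncard_neighborSet_of_mem_core hg, rfl⟩
    · rintro ⟨u, hu, rfl⟩
      by_contra hc
      have := e.ncard_neighborSet_of_notMem_core hc
      simp only [Set.mem_ofPred_eq] at hu
      omega
  rwa [this, Set.ncard_image_of_injective _ e.injective]

/-- The input network on the subtree in which the node `u` has the identifier `ℓ u + 1`. -/
noncomputable def network (ℓ : Fin m ≃ Fin m) : Network k m where
  graph := e.graph
  regular := e.graph_isRegularTree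
  orientation := e.orientation
  ident u := ℓ u + 1
  ident_bij := by
    refine ⟨fun u _ => ⟨Nat.le_add_left _ _, (ℓ u).2⟩, fun u _ v _ h => ℓ.injective (Fin.ext (by simpa using h)),
      fun i hi => ⟨ℓ.symm ⟨i - 1, by have := hi.1; have := hi.2; omega⟩, trivial, ?_⟩⟩
    have := hi.1
    simp only [Equiv.apply_symm_apply]
    omega

end SubtreeNumbering

/-- At an element of maximal norm in `I`, at most one direction decreases the norm and there are at
least two directions, so some child lies outside `I`. -/
theorem exists_insert_closed (hk : 1 ≤ k) {I : Set (FreeGroup (Fin k))} (hI : I.Finite)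
    (h1 : 1 ∈ I) : ∃ g ∉ I, parent g ∈ I := by
  obtain ⟨g, hg, hmax⟩ := hI.exists_maximalFor norm I ⟨1, h1⟩
  obtain ⟨p, hp⟩ : ∃ p : Direction k, (gen p * g).norm = g.norm + 1 := by
    by_contra! h
    have h' := fun p => (norm_gen_mul p g).resolve_left (h p)
    simpa using eq_of_norm_gen_mul (h' (⟨0, hk⟩, true)) (h' (⟨0, hk⟩, false))
  refine ⟨gen p * g, fun hpg => ?_, by rwa [parent_gen_mul hp]⟩
  have := hmax hpg (by omega)
  omega

/-- Every large enough regular tree size is the size of a subtree whose core contains a given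
ball. -/
theorem exists_subtreeNumbering (hk : 1 ≤ k) (Q i : ℕ) (hi : (2 * k + 1) ^ Q ≤ i) :
    ∃ e : SubtreeNumbering k ((2 * k - 1) * i + 2), ball k Q ⊆ e.core := by
  have key : ∀ j, (ball k Q).ncard ≤ j → ∃ I : Set (FreeGroup (Fin k)), I.Finite ∧ 1 ∈ I ∧
      (∀ g ∈ I, parent g ∈ I) ∧ ball k Q ⊆ I ∧ I.ncard = j := by
    intro j hj
    induction j, hj using Nat.le_induction with
    | base =>
      exact ⟨ball k Q, finite_ball k Q, by simp [ball], fun g hg => (norm_parent_le g).trans hg,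
        le_rfl, rfl⟩
    | succ j hj ih =>
      obtain ⟨I, hfin, h1, hpar, hQ, hcard⟩ := ih
      obtain ⟨g, hg, hg'⟩ := exists_insert_closed hk hfin h1
      refine ⟨insert g I, hfin.insert g, Or.inr h1, ?_, hQ.trans (Set.subset_insert _ _), ?_⟩
      · rintro h (rfl | hh)
        · exact Or.inr hg'
        · exact Or.inr (hpar h hh)
      · rw [Set.ncard_insert_of_notMem hg hfin, hcard]
  obtain ⟨I, hfin, h1, hpar, hQ, rfl⟩ := key i ((ncard_ball_le k Q).trans hi)
  have hVfin : {g | parent g ∈ I}.Finite := by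
    refine (hfin.union (Set.finite_iUnion fun p : Direction k => hfin.image (gen p * ·))).subset ?_
    intro g hg
    by_cases hg1 : g = 1
    · exact Or.inl (hg1 ▸ h1)
    · obtain ⟨p, hp, -⟩ := exists_eq_gen_mul_parent hg1
      exact Or.inr (Set.mem_iUnion.2 ⟨p, _, hg, hp.symm⟩)
  have := hVfin.to_subtype
  let eq := Finite.equivFin {g | parent g ∈ I}
  let e : SubtreeNumbering k (Nat.card {g | parent g ∈ I}) :=
    { core := I
      one_mem := h1
      parent_mem := hpar
      toFun := fun u => (eq.symm u).1
      injective := Subtype.val_injective.comp eq.symm.injective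
      mem_range_iff := fun g => ⟨by rintro ⟨u, rfl⟩; exact (eq.symm u).2,
        fun hg => ⟨eq ⟨g, hg⟩, congrArg Subtype.val (eq.symm_apply_apply ⟨g, hg⟩)⟩⟩ }
  have hcard : Nat.card {g | parent g ∈ I} = (2 * k - 1) * I.ncard + 2 := e.card_eq hk
  have he : ∃ e : SubtreeNumbering k (Nat.card {g | parent g ∈ I}), ball k Q ⊆ e.core := ⟨e, hQ⟩
  rwa [hcard] at he

end FreeGroup

/-! ### Running the algorithm on the infinite tree -/

namespace LocalAlgorithm

open FreeGroup

variable {k m : ℕ} {C : Type}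

/-- The state after `t` rounds of the node `1` in the infinite tree, if the identifiers are given by
`x` (up to a shift by one) and the random bits of a node are determined by its identifier. -/
def treeState (A : LocalAlgorithm k C) (bits : Fin m → ℕ → Bool) :
    ℕ → (FreeGroup (Fin k) → Fin m) → A.State
  | 0, x => A.init m (x 1 + 1) Set.univ (bits (x 1))
  | t + 1, x =>
    if (A.output (A.treeState bits t x)).isSome then A.treeState bits t x
    else A.receive (A.treeState bits t x) fun p =>
      if (A.output (A.treeState bits t (shift p x))).isSome then none
      else some (A.send (A.treeState bits t (shift p x)) p.opp)

theorem dependsOn_treeState (A : LocalAlgorithm k C) (bits : Fin m → ℕ → Bool) (t : ℕ) :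
    DependsOn (A.treeState bits t) (ball k t) := by
  induction t with
  | zero =>
    intro x y h
    simp only [treeState, h 1 (by simp [ball])]
  | succ t ih =>
    intro x y h
    have h0 : A.treeState bits t x = A.treeState bits t y :=
      ih fun g hg => h g (ball_mono (Nat.le_succ t) hg)
    have h1 : ∀ p, A.treeState bits t (shift p x) = A.treeState bits t (shift p y) := fun p =>
      dependsOn_comp_shift ih p fun g hg => h g (edgeBall_subset_ball p t (Or.inr hg))
    simp only [treeState, h0, h1]

/-- Views in the infinite tree extend by right multiplication, the subtree by left multiplication;
hence the node `g` of the view is `g⁻¹ * e.toFun u`. The view must lie in the core because leaves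
know their degree. -/
theorem stateAfter_network (A : LocalAlgorithm k C) (e : SubtreeNumbering k m) (ℓ : Fin m ≃ Fin m)
    (bits : Fin m → ℕ → Bool) (t : ℕ) (u : Fin m) (x : FreeGroup (Fin k) → Fin m)
    (hx : ∀ g ∈ ball k t, ∃ w, e.toFun w = g⁻¹ * e.toFun u ∧ e.toFun w ∈ e.core ∧ ℓ w = x g) :
    A.stateAfter (e.network ℓ) (fun w => bits (ℓ w)) t u = A.treeState bits t x := by
  induction t generalizing u x with
  | zero =>
    obtain ⟨w, hw, hw', hwx⟩ := hx 1 (by simp [ball])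
    rw [inv_one, one_mul] at hw
    obtain rfl := e.injective hw
    have : {p | (e.network ℓ).orientation.nbr w p ≠ none} = Set.univ := by
      ext p
      obtain ⟨v, hv⟩ := e.exists_toFun_eq_gen_mul hw' p.opp
      have : (e.network ℓ).orientation.nbr w p = some v := e.nbr_eq_some.2 hv
      simp [this]
    simp only [stateAfter, treeState, this, hwx]
    rw [← hwx]
    rfl
  | succ t ih =>
    have h0 := ih u x fun g hg => hx g (ball_mono (Nat.le_succ t) hg)
    have hu : e.toFun u ∈ e.core := by
      obtain ⟨w, hw, hw', -⟩ := hx 1 (by simp [ball])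
      rwa [hw, inv_one, one_mul] at hw'
    simp only [stateAfter, treeState, h0]
    congr 2
    ext1 p
    obtain ⟨v, hv⟩ := e.exists_toFun_eq_gen_mul hu p.opp
    have hn : (e.network ℓ).orientation.nbr u p = some v := e.nbr_eq_some.2 hv
    have h1 := ih v (shift p x) fun g hg => by
      obtain ⟨w, hw, hw', hwx⟩ := hx (gen p * g) (edgeBall_subset_ball p t
        (Or.inr (by simpa [gen_opp] using hg)))
      exact ⟨w, by rw [hw, hv, gen_opp, mul_inv_rev, mul_assoc], hw', hwx⟩
    rw [hn]
    simp only [h1]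

/-- If the algorithm succeeds, then the coloring of the infinite tree is not monochromatic around a
node whose neighborhood looks like the infinite tree. -/
theorem notMem_monochromatic_of_mem_successEvent (A : LocalAlgorithm k C)
    (e : SubtreeNumbering k m) (ℓ : Fin m ≃ Fin m) (bits : Fin m → ℕ → Bool) (T : ℕ)
    (h : (fun w => bits (ℓ w)) ∈ A.successEvent (e.network ℓ) T) (u : Fin m)
    (x : FreeGroup (Fin k) → Fin m)
    (hx : ∀ g ∈ ball k (T + 1),
      ∃ w, e.toFun w = g⁻¹ * e.toFun u ∧ e.toFun w ∈ e.core ∧ ℓ w = x g) :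
    x ∉ monochromatic fun y => A.output (A.treeState bits T y) := by
  obtain ⟨φ, hφ, hweak⟩ := h
  obtain ⟨v, hadj, hne⟩ := hweak u
  obtain ⟨p, hp⟩ := (e.network ℓ).orientation.adj_iff u v |>.1 hadj
  have hv : e.toFun v = gen p.opp * e.toFun u := e.nbr_eq_some.1 hp
  have hu' := hφ u
  have hv' := hφ v
  rw [outputAfter, stateAfter_network A e ℓ bits T u x
    fun g hg => hx g (ball_mono (Nat.le_succ T) hg)] at hu'
  rw [outputAfter, stateAfter_network A e ℓ bits T v (shift p x) fun g hg => by
    obtain ⟨w, hw, hw', hwx⟩ := hx (gen p * g) (edgeBall_subset_ball p T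
      (Or.inr (by simpa [gen_opp] using hg)))
    exact ⟨w, by rw [hw, hv, gen_opp, mul_inv_rev, mul_assoc], hw', hwx⟩] at hv'
  intro hmono
  have := hmono p
  simp only at this
  rw [hu', hv'] at this
  exact hne (Option.some_inj.1 this)

theorem measurableSet_successEvent [Finite C] (A : LocalAlgorithm k C) (N : Network k m) (T : ℕ)
    (h : ∀ v c, MeasurableSet {ω | A.outputAfter N T v ω = some c}) :
    MeasurableSet (A.successEvent N T) := by
  have : A.successEvent N T = ⋃ φ ∈ {φ : Fin m → C | IsWeakColoring N.graph φ},
      ⋂ v, {ω | A.outputAfter N T v ω = some (φ v)} := by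
    ext ω
    simp [successEvent, and_comm]
  rw [this]
  exact MeasurableSet.biUnion (Set.toFinite _).countable fun φ _ => MeasurableSet.iInter fun v => h v _

end LocalAlgorithm

/-! ### Fixing the random bits and counting identifier assignments -/

instance : IsProbabilityMeasure coinFlips := by
  unfold coinFlips
  infer_instance

instance (n : ℕ) : IsProbabilityMeasure (randomBits n) := by
  unfold randomBits
  infer_instance

/-- This allows the bits to belong to identifiers instead of nodes, so that one outcome can serve
all identifier assignments. -/
theorem measurePreserving_comp_equiv (n : ℕ) (ℓ : Fin n ≃ Fin n) :
    MeasurePreserving (fun (bits : Fin n → ℕ → Bool) w => bits (ℓ w)) (randomBits n)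
      (randomBits n) := by
  have := measurePreserving_piCongrLeft (fun _ : Fin n => coinFlips) ℓ.symm
  convert! this using 1
  ext bits w
  simp [MeasurableEquiv.coe_piCongrLeft, Equiv.piCongrLeft_apply]

/-- If every one of finitely many events has probability at least `q`, then some outcome lies in
at least a fraction `q` of them. -/
theorem exists_card_mul_le_card_filter {Ω α : Type*} [MeasurableSpace Ω] (μ : Measure Ω)
    [IsProbabilityMeasure μ] [Fintype α] (S : α → Set Ω) (hS : ∀ a, MeasurableSet (S a))
    (q : ENNReal) (h : ∀ a, q ≤ μ (S a)) :
    ∃ ω, q * Fintype.card α ≤ ({a | ω ∈ S a} : Set α).ncard := by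
  classical
  have h1 : ∫⁻ ω, ∑ a, (S a).indicator 1 ω ∂μ = ∑ a, μ (S a) := by
    rw [lintegral_finsetSum _ fun a _ => measurable_one.indicator (hS a)]
    simp [hS]
  obtain ⟨ω, hω⟩ := exists_lintegral_le (μ := μ) (f := fun ω => ∑ a, (S a).indicator 1 ω) (by
    rw [h1]; exact ENNReal.sum_ne_top.2 fun a _ => measure_ne_top _ _)
  refine ⟨ω, ?_⟩
  rw [h1] at hω
  calc q * Fintype.card α = ∑ _ : α, q := by simp [mul_comm]
    _ ≤ ∑ a, μ (S a) := Finset.sum_le_sum fun a _ => h a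
    _ ≤ _ := hω
    _ = _ := by
      rw [Set.ncard_eq_toFinset_card']
      simp [Set.indicator_apply]

namespace FreeGroup

variable {k : ℕ}

theorem ball_inv_mul_pow_eq {T : ℕ} {a : Fin k} {i j : ℕ} {g h : FreeGroup (Fin k)}
    (hg : g ∈ ball k T) (hh : h ∈ ball k T)
    (heq : g⁻¹ * of a ^ ((2 * T + 1) * i) = h⁻¹ * of a ^ ((2 * T + 1) * j)) : i = j ∧ g = h := by
  wlog hij : i ≤ j generalizing i j g h
  · have := this hh hg heq.symm (by omega)
    exact ⟨this.1.symm, this.2.symm⟩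
  obtain ⟨d, rfl⟩ := Nat.exists_eq_add_of_le hij
  -- Centers are `2 * T + 1` apart along the powers of one generator, while `h * g⁻¹` has norm at
  -- most `2 * T`; only `d = 0` is possible.
  have h1 : of a ^ ((2 * T + 1) * d) = h * g⁻¹ := by
    rw [show (2 * T + 1) * (i + d) = (2 * T + 1) * d + (2 * T + 1) * i by ring, pow_add, ← mul_assoc] at heq
    have h0 := mul_right_cancel heq
    rw [h0, mul_inv_cancel_left]
  have h2 := norm_mul_le h g⁻¹
  rw [← h1, norm_of_pow, norm_inv_eq] at h2
  simp only [ball, Set.mem_ofPred_eq] at hg hh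
  have hd : d = 0 := by
    rcases d with _ | d
    · rfl
    · nlinarith
  subst hd
  rw [mul_zero, pow_zero] at h1
  exact ⟨rfl, (mul_inv_eq_one.1 h1.symm).symm⟩

theorem norm_inv_mul_pow_le {T : ℕ} {g : FreeGroup (Fin k)} (hg : g ∈ ball k T) (a : Fin k)
    {i M : ℕ} (hi : i < M) : (g⁻¹ * of a ^ ((2 * T + 1) * i)).norm ≤ (2 * T + 1) * M := by
  refine (norm_mul_le _ _).trans ?_
  rw [norm_inv_eq, norm_of_pow]
  simp only [ball, Set.mem_ofPred_eq] at hg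
  nlinarith

noncomputable instance (R : ℕ) : Fintype (ball k R) := (finite_ball k R).fintype

end FreeGroup

open FreeGroup

theorem measureReal_restrict_mem {ι X : Type*} [Fintype X] [Nonempty X] [MeasurableSpace X]
    [DiscreteMeasurableSpace X] (B : Set ι) [Fintype B] (G : Set (B → X)) :
    (Measure.infinitePi fun _ : ι => (PMF.uniformOfFintype X).toMeasure).real
      {x | (fun i : B => x i) ∈ G} = G.ncard / (Fintype.card X : ℝ) ^ Fintype.card B := by
  classical
  set μ := Measure.infinitePi fun _ : ι => (PMF.uniformOfFintype X).toMeasure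
  have hcyl : ∀ r : B → X, {x : ι → X | (fun i : B => x i) = r} =
      (B.toFinset : Set ι).pi fun i => if h : i ∈ B then {r ⟨i, h⟩} else ∅ := by
    intro r
    ext x
    simp only [Set.mem_ofPred_eq, funext_iff, Subtype.forall, Set.mem_pi, Set.coe_toFinset]
    exact forall₂_congr fun i hi => by simp [hi]
  have hcyl_meas : ∀ r : B → X, MeasurableSet {x : ι → X | (fun i : B => x i) = r} := fun r => by
    rw [hcyl]
    exact .pi (Finset.countable_toSet _) fun _ _ => .of_discrete
  have hcyl_real : ∀ r : B → X, μ.real {x : ι → X | (fun i : B => x i) = r} =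
      1 / (Fintype.card X : ℝ) ^ Fintype.card B := by
    intro r
    rw [hcyl, Measure.real, Measure.infinitePi_pi _ fun _ _ => .of_discrete, ENNReal.toReal_prod]
    rw [Finset.prod_congr rfl (g := fun _ => 1 / (Fintype.card X : ℝ)) fun i hi => ?_]
    · simp
    · have hi' : i ∈ B := by simpa using hi
      rw [dif_pos hi', PMF.toMeasure_apply_singleton _ _ .of_discrete,
        PMF.uniformOfFintype_apply]
      simp
  have hU : {x : ι → X | (fun i : B => x i) ∈ G} =
      ⋃ r ∈ G.toFinset, {x : ι → X | (fun i : B => x i) = r} := by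
    ext x
    simp
  rw [hU, measureReal_biUnion_finset, Finset.sum_congr rfl fun r _ => hcyl_real r,
    Finset.sum_const, Set.ncard_eq_toFinset_card', nsmul_eq_mul, mul_one_div]
  · intro r _ r' _ hne
    exact Set.disjoint_left.2 fun x hx hx' => hne (hx.symm.trans hx')
  · exact fun r _ => hcyl_meas r

namespace LocalAlgorithm

variable {k m : ℕ}

/-- The labelings of a ball that do not force the coloring to be monochromatic around its center. -/
def goodLabelings {C : Type} (A : LocalAlgorithm k C) (bits : Fin m → ℕ → Bool) (T : ℕ) :
    Set (ball k (T + 1) → Fin m) :=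
  {r | ∀ x : FreeGroup (Fin k) → Fin m, (fun g : ball k (T + 1) => x g) = r →
    x ∉ monochromatic fun y => A.output (A.treeState bits T y)}

theorem ncard_goodLabelings_le {C : Type} (A : LocalAlgorithm k C) (bits : Fin m → ℕ → Bool)
    (T : ℕ) [Nonempty (Fin m)] :
    ((A.goodLabelings bits T).ncard : ℝ) ≤
      (1 - (Measure.infinitePi fun _ : FreeGroup (Fin k) =>
        (PMF.uniformOfFintype (Fin m)).toMeasure).real
          (monochromatic fun y => A.output (A.treeState bits T y))) *
        (m : ℝ) ^ Fintype.card (ball k (T + 1)) := by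
  have hm : (0 : ℝ) < m := by
    have := Fin.pos_iff_nonempty.2 ‹Nonempty (Fin m)›
    exact_mod_cast this
  have hdep : DependsOn (fun y => A.output (A.treeState bits T y)) (ball k T) := fun x y h => by
    simp only [A.dependsOn_treeState bits T h]
  have hmeas := (dependsOn_monochromatic hdep).measurableSet_of_finite (finite_ball k _)
  have h1 := measureReal_restrict_mem (X := Fin m) (ball k (T + 1)) (A.goodLabelings bits T)
  rw [Fintype.card_fin] at h1
  rw [← div_le_iff₀ (by positivity), ← h1, ← probReal_compl_eq_one_sub hmeas]
  exact measureReal_mono fun x hx => hx x rfl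

/-- The left side counts the injective labelings of `M` disjoint balls. Averaging gives bits with
which at least half of them lead to success, and success makes the labeling of every single ball
good. -/
theorem exists_descFactorial_le (A : LocalAlgorithm k (Fin 2)) (e : SubtreeNumbering k m)
    {T M : ℕ} (hA : A.FindsWeakColoring m T (1 / 2)) (a : Fin k)
    (hcore : ball k ((2 * (T + 1) + 1) * M) ⊆ e.core) :
    ∃ bits : Fin m → ℕ → Bool,
      m.descFactorial (M * Fintype.card (ball k (T + 1))) ≤
        2 * (A.goodLabelings bits T).ncard ^ M := by
  classical
  have hmem : ∀ z : Fin M × ball k (T + 1),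
      ((z.2 : FreeGroup (Fin k))⁻¹ * of a ^ ((2 * (T + 1) + 1) * (z.1 : ℕ))) ∈ e.core := fun z =>
    hcore (norm_inv_mul_pow_le z.2.2 a z.1.2)
  choose P hP using fun z => (e.mem_range_iff _).2 (e.parent_mem _ (hmem z))
  have hPinj : Function.Injective P := by
    intro z z' h
    have h1 := congrArg e.toFun h
    rw [hP, hP] at h1
    obtain ⟨h2, h3⟩ := ball_inv_mul_pow_eq z.2.2 z'.2.2 h1
    exact Prod.ext (Fin.ext h2) (Subtype.ext h3)
  -- Each injective labeling of the balls is completed to one identifier assignment of the whole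
  -- network, by an arbitrary choice.
  choose ℓ hℓ using fun y : (Fin M × ball k (T + 1)) ↪ Fin m =>
    Equiv.Perm.exists_extending_pair P y hPinj y.injective
  obtain ⟨bits, hbits⟩ := exists_card_mul_le_card_filter (randomBits m)
    (fun y => (fun (bits : Fin m → ℕ → Bool) w => bits (ℓ y w)) ⁻¹'
      A.successEvent (e.network (ℓ y)) T)
    (fun y => (measurePreserving_comp_equiv m (ℓ y)).measurable
      (A.measurableSet_successEvent _ T (hA _).1)) (1 / 2) fun y => by
    rw [(measurePreserving_comp_equiv m (ℓ y)).measure_preimage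
      (A.measurableSet_successEvent _ T (hA _).1).nullMeasurableSet]
    exact (hA _).2
  refine ⟨bits, ?_⟩
  set S : Set ((Fin M × ball k (T + 1)) ↪ Fin m) := {y | bits ∈
    (fun (bits : Fin m → ℕ → Bool) w => bits (ℓ y w)) ⁻¹' A.successEvent (e.network (ℓ y)) T}
  have hS : S.ncard ≤ (A.goodLabelings bits T).ncard ^ M := by
    have h1 : (Set.univ.pi fun _ : Fin M => A.goodLabelings bits T).ncard =
        (A.goodLabelings bits T).ncard ^ M := by
      rw [← Nat.card_coe_set_eq, Nat.card_congr (Equiv.Set.univPi _), Nat.card_pi]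
      simp only [Nat.card_coe_set_eq, Finset.prod_const, Finset.card_univ, Fintype.card_fin]
    rw [← h1]
    refine Set.ncard_le_ncard_of_injOn (fun y j g => y (j, g)) (fun y hy j _ x hx => ?_)
      (fun y _ y' _ h => ?_) (Set.toFinite _)
    · refine A.notMem_monochromatic_of_mem_successEvent e (ℓ y) bits T hy (P (j, ⟨1, by simp [ball]⟩))
        x fun g hg => ⟨P (j, ⟨g, hg⟩), ?_, ?_, ?_⟩
      · simp [hP]
      · rw [hP]
        exact hmem _
      · rw [hℓ]
        exact (congrFun hx ⟨g, hg⟩).symm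
    · ext z
      exact congrArg Fin.val (congrFun (congrFun h z.1) z.2)
  have hcard : Fintype.card ((Fin M × ball k (T + 1)) ↪ Fin m) =
      m.descFactorial (M * Fintype.card (ball k (T + 1))) := by
    rw [Fintype.card_embedding_eq]
    simp
  rw [hcard] at hbits
  have h2 : (m.descFactorial (M * Fintype.card (ball k (T + 1))) : ENNReal) ≤ 2 * S.ncard := by
    calc (m.descFactorial (M * Fintype.card (ball k (T + 1))) : ENNReal)
        = 2 * (1 / 2 * m.descFactorial (M * Fintype.card (ball k (T + 1)))) := by
          rw [← mul_assoc, one_div, ENNReal.mul_inv_cancel (by norm_num) (by norm_num), one_mul]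
      _ ≤ 2 * S.ncard := by gcongr
  have h3 : m.descFactorial (M * Fintype.card (ball k (T + 1))) ≤ 2 * S.ncard := by
    exact_mod_cast h2
  exact h3.trans (Nat.mul_le_mul_left 2 hS)

end LocalAlgorithm

/-! ### From the counting to a bound on the size of the tree -/

/-- The birthday bound: by Bernoulli's inequality, `(1 - m / n) ^ m` is at least `1 - m ^ 2 / n`,
which is at least `1 / 2`. -/
theorem pow_le_two_mul_descFactorial {n m : ℕ} (h : 2 * m ^ 2 ≤ n) :
    n ^ m ≤ 2 * n.descFactorial m := by
  rcases Nat.eq_zero_or_pos m with rfl | hm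
  · simp
  have hmn : m ≤ n := by nlinarith
  have hn : (0 : ℝ) < n := by
    have : 0 < n := by omega
    exact_mod_cast this
  have hR : (2 * m ^ 2 : ℝ) ≤ n := by exact_mod_cast h
  have hm1 : (m : ℝ) ≤ n := by exact_mod_cast hmn
  have hdiv : (m : ℝ) / n ≤ 1 := (div_le_one hn).2 hm1
  have h1 : (1 : ℝ) / 2 ≤ (1 - m / n) ^ m := by
    have h2 := one_add_mul_le_pow (a := -(m / n : ℝ)) (by linarith) m
    have h3 : (m : ℝ) * (m / n) ≤ 1 / 2 := by
      rw [mul_div_assoc', div_le_iff₀ hn]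
      nlinarith
    rw [← sub_eq_add_neg] at h2
    linarith
  have h4 : (n : ℝ) ^ m ≤ 2 * (n - m : ℝ) ^ m := by
    have : (n - m : ℝ) = n * (1 - m / n) := by field_simp
    rw [this, mul_pow]
    have : (0 : ℝ) < n ^ m := by positivity
    nlinarith
  have h5 : n ^ m ≤ 2 * (n - m) ^ m := by
    have : ((n - m : ℕ) : ℝ) = n - m := Nat.cast_sub hmn
    rw [← this] at h4
    exact_mod_cast h4
  refine h5.trans (Nat.mul_le_mul_left 2 ((Nat.pow_le_pow_left (by omega) m).trans
    (Nat.pow_sub_le_descFactorial n m)))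

/-- An algorithm with success probability `1 / 2` needs to run for many rounds in large trees. -/
theorem LocalAlgorithm.FindsWeakColoring.card_lt {k : ℕ} (hk : 1 ≤ k) {n T Y : ℕ}
    (hY : Y = iteratedExp (5 * T + 2) (3 + 2 * (2 * k + 1) ^ 2))
    (hn : ∃ G : SimpleGraph (Fin n), IsRegularTree (2 * k) G)
    {A : LocalAlgorithm k (Fin 2)} (hA : A.FindsWeakColoring n T (1 / 2)) :
    n < 2 * k * (2 * k + 1) ^ ((2 * (T + 1) + 1) * (2 * Y)) + 2 ∨
      n < 2 * (2 * Y * (2 * k + 1) ^ (T + 1)) ^ 2 := by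
  by_contra! hcon
  obtain ⟨G, hG⟩ := hn
  obtain ⟨i, hni⟩ : ∃ i, n = (2 * k - 1) * i + 2 := ⟨_, hG.card_eq hk⟩
  -- The core has room for all balls, since it contains about a fraction `1 / (2 * k - 1)` of the
  -- nodes.
  have hi : (2 * k + 1) ^ ((2 * (T + 1) + 1) * (2 * Y)) ≤ i := by
    have h1 : (2 * k - 1) * i ≤ 2 * k * i := Nat.mul_le_mul_right _ (by omega)
    exact Nat.le_of_mul_le_mul_left (c := 2 * k) (by omega) (by omega)
  obtain ⟨e, he⟩ : ∃ e : SubtreeNumbering k n, ball k ((2 * (T + 1) + 1) * (2 * Y)) ⊆ e.core :=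
    hni ▸ exists_subtreeNumbering hk _ i hi
  obtain ⟨bits, hbits⟩ := A.exists_descFactorial_le e hA ⟨0, hk⟩ he
  have : Nonempty (Fin n) := ⟨⟨0, by omega⟩⟩
  set b := Fintype.card (ball k (T + 1)) with hb
  have hbR : b ≤ (2 * k + 1) ^ (T + 1) := by
    rw [hb, ← Nat.card_eq_fintype_card, Nat.card_coe_set_eq]
    exact ncard_ball_le k (T + 1)
  have h1 : n ^ (2 * Y * b) ≤ 2 * n.descFactorial (2 * Y * b) := by
    refine pow_le_two_mul_descFactorial (le_trans ?_ hcon.2)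
    gcongr
  have h2 := A.ncard_goodLabelings_le bits T
  have hY0 : 0 < Y := by
    rw [hY]
    exact lt_of_lt_of_le (by positivity) (le_iteratedExp _ _)
  have hYR : (1 : ℝ) ≤ Y := by exact_mod_cast hY0
  have h3 : 1 / (Y : ℝ) ≤ (Measure.infinitePi fun _ : FreeGroup (Fin k) =>
      (PMF.uniformOfFintype (Fin n)).toMeasure).real
        (monochromatic fun y => A.output (A.treeState bits T y)) := by
    -- The colors are `Option (Fin 2)`, since a node may not have halted; this is the `3` in `Y`.
    have := inv_iteratedExp_le_measureReal_monochromatic (X := Fin n)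
      (ν := (PMF.uniformOfFintype (Fin n)).toMeasure) hk T
      (f := fun y => A.output (A.treeState bits T y))
      fun x y h => by simp only [A.dependsOn_treeState bits T h]
    simpa [hY] using this
  have h4 : ((A.goodLabelings bits T).ncard : ℝ) ≤ (1 - 1 / Y) * (n : ℝ) ^ b := by
    refine h2.trans ?_
    gcongr
  have h5 : ((A.goodLabelings bits T).ncard : ℝ) ^ (2 * Y) ≤
      Real.exp (-1) ^ 2 * (n : ℝ) ^ (2 * Y * b) := by
    calc _ ≤ ((1 - 1 / Y) * (n : ℝ) ^ b) ^ (2 * Y) := by gcongr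
      _ = ((1 - 1 / Y) ^ Y) ^ 2 * (n : ℝ) ^ (2 * Y * b) := by
        rw [mul_pow, ← pow_mul, ← pow_mul, mul_comm Y 2, mul_comm b]
      _ ≤ _ := by
        have h6 : (0 : ℝ) ≤ 1 - 1 / Y := by
          rw [sub_nonneg, div_le_one (by linarith)]
          exact hYR
        gcongr
        exact Real.one_sub_div_pow_le_exp_neg hYR
  have h6 : (n : ℝ) ^ (2 * Y * b) ≤ 4 * (A.goodLabelings bits T).ncard ^ (2 * Y) := by
    have : n ^ (2 * Y * b) ≤ 4 * (A.goodLabelings bits T).ncard ^ (2 * Y) := by omega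
    exact_mod_cast this
  -- One factor `1 / 2` is lost to the success probability and one to injectivity; `2 * Y` balls
  -- suffice to beat both.
  have h7 : Real.exp (-1) ^ 2 < 1 / 4 := by
    have h8 : Real.exp (-1) < 1 / 2 := by
      rw [Real.exp_neg, inv_lt_comm₀ (Real.exp_pos _) (by norm_num)]
      have := Real.exp_one_gt_d9
      norm_num
      linarith
    have := Real.exp_pos (-1)
    nlinarith
  have h9 : (0 : ℝ) < (n : ℝ) ^ (2 * Y * b) := by
    have : (0 : ℝ) < n := by
      have : 0 < n := by omega
      exact_mod_cast this
    positivity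
  nlinarith

/-! ### From towers to the iterated logarithm -/

theorem add_le_iteratedExp (i y : ℕ) : i + y ≤ iteratedExp i y := by
  induction i with
  | zero => simp [iteratedExp_zero]
  | succ i ih =>
    rw [iteratedExp_succ]
    have : iteratedExp i y < 2 ^ iteratedExp i y := Nat.lt_two_pow_self
    omega

theorem iteratedExp_le_iteratedExp_one (i y : ℕ) : iteratedExp i y ≤ iteratedExp (i + y) 1 := by
  rw [iteratedExp_add]
  exact iteratedExp_mono ((Nat.le_add_right y 1).trans (add_le_iteratedExp y 1))

theorem logStar_le_of_le_iteratedExp {i : ℕ} {x : ℝ} (h : x ≤ iteratedExp i 1) :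
    logStar x ≤ i := by
  suffices ∃ j ≤ i, (Real.logb 2)^[j] x ≤ 1 by
    obtain ⟨j, hj, h⟩ := this
    exact (Nat.sInf_le h).trans hj
  induction i generalizing x with
  | zero => exact ⟨0, le_rfl, by simpa [iteratedExp_zero] using h⟩
  | succ i ih =>
    by_cases hx : x ≤ 1
    · exact ⟨0, Nat.zero_le _, hx⟩
    · have hx0 : 0 < x := by linarith
      obtain ⟨j, hj, hj'⟩ := ih (x := Real.logb 2 x) (by
        rw [Real.logb_le_iff_le_rpow one_lt_two hx0, Real.rpow_natCast]
        rw [iteratedExp_succ] at h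
        exact_mod_cast h)
      exact ⟨j + 1, by omega, hj'⟩

theorem mul_pow_add_two_le_iteratedExp_three {K Y s : ℕ} (hK : K ≤ Y) (hs : s ≤ Y) (hY : 4 ≤ Y) :
    K * K ^ (s * (2 * Y)) + 2 ≤ iteratedExp 3 Y := by
  have h1 : K ^ (s * (2 * Y)) ≤ 2 ^ (2 * Y ^ 3) := by
    calc K ^ (s * (2 * Y)) ≤ (2 ^ Y) ^ (s * (2 * Y)) :=
          Nat.pow_le_pow_left (hK.trans Nat.lt_two_pow_self.le) _
      _ = 2 ^ (Y * (s * (2 * Y))) := (pow_mul _ _ _).symm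
      _ ≤ _ := Nat.pow_le_pow_right two_pos (by
        calc Y * (s * (2 * Y)) ≤ Y * (Y * (2 * Y)) := by gcongr
          _ = _ := by ring)
  have h2 : Y + 2 ≤ 2 ^ Y := (by omega : Y + 2 ≤ 2 * Y).trans (two_mul_le_two_pow Y)
  have h3 : 1 ≤ 2 ^ (2 * Y ^ 3) := Nat.one_le_pow _ _ two_pos
  have h4 : 2 * Y ^ 3 + Y ≤ iteratedExp 2 Y := by
    refine le_trans ?_ (pow_le_iteratedExp_two hY hY)
    have : 4 * Y ^ 3 ≤ Y ^ 4 := by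
      rw [pow_succ Y 3, mul_comm]
      exact Nat.mul_le_mul_left _ hY
    have : Y ≤ Y ^ 3 := Nat.le_self_pow (by norm_num) Y
    omega
  calc K * K ^ (s * (2 * Y)) + 2 ≤ Y * 2 ^ (2 * Y ^ 3) + 2 := by gcongr
    _ ≤ (Y + 2) * 2 ^ (2 * Y ^ 3) := by nlinarith
    _ ≤ 2 ^ Y * 2 ^ (2 * Y ^ 3) := Nat.mul_le_mul_right _ h2
    _ = 2 ^ (2 * Y ^ 3 + Y) := by rw [← pow_add, add_comm]
    _ ≤ 2 ^ iteratedExp 2 Y := Nat.pow_le_pow_right two_pos h4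
    _ = _ := (iteratedExp_succ 2 Y).symm

theorem two_mul_sq_le_iteratedExp_three {K Y s : ℕ} (hK : K ≤ Y) (hs : s ≤ Y) (hY : 8 ≤ Y) :
    2 * (2 * Y * K ^ s) ^ 2 ≤ iteratedExp 3 Y := by
  calc 2 * (2 * Y * K ^ s) ^ 2 ≤ 2 * (2 * Y * Y ^ Y) ^ 2 := by
        have : K ^ s ≤ Y ^ Y := (Nat.pow_le_pow_left hK s).trans (Nat.pow_le_pow_right (by omega) hs)
        gcongr
    _ = 8 * (Y ^ 2 * Y ^ (2 * Y)) := by ring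
    _ ≤ Y * (Y ^ 2 * Y ^ (2 * Y)) := Nat.mul_le_mul_right _ hY
    _ = Y ^ (2 * Y + 3) := by ring
    _ ≤ (2 ^ Y) ^ (2 * Y + 3) := Nat.pow_le_pow_left Nat.lt_two_pow_self.le _
    _ = 2 ^ (Y * (2 * Y + 3)) := (pow_mul _ _ _).symm
    _ ≤ 2 ^ iteratedExp 2 Y := by
      refine Nat.pow_le_pow_right two_pos (le_trans ?_ (pow_le_iteratedExp_two (m := 3)
        (by omega) (by omega)))
      calc Y * (2 * Y + 3) ≤ Y * (Y * Y) := Nat.mul_le_mul_left Y (by nlinarith)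
        _ = Y ^ 3 := by ring
    _ = _ := (iteratedExp_succ 2 Y).symm

/-- Both alternatives in `card_lt` are at most three exponentials above `Y`, and starting the tower
at `1` instead of `3 + B` costs at most `3 + B` more. -/
theorem LocalAlgorithm.FindsWeakColoring.card_lt_iteratedExp {k : ℕ} (hk : 1 ≤ k) {n T : ℕ}
    (hn : ∃ G : SimpleGraph (Fin n), IsRegularTree (2 * k) G)
    {A : LocalAlgorithm k (Fin 2)} (hA : A.FindsWeakColoring n T (1 / 2)) :
    n < iteratedExp (5 * T + (8 + 2 * (2 * k + 1) ^ 2)) 1 := by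
  set B := 2 * (2 * k + 1) ^ 2 with hB
  set Y := iteratedExp (5 * T + 2) (3 + B) with hY
  have hYle : 5 * T + 2 + (3 + B) ≤ Y := add_le_iteratedExp _ _
  have hK : 2 * k + 1 ≤ B := by nlinarith
  have h1 : n < iteratedExp 3 Y := by
    rcases hA.card_lt hk hY hn with h | h
    · refine h.trans_le (le_trans ?_ (mul_pow_add_two_le_iteratedExp_three (K := 2 * k + 1)
        (s := 2 * (T + 1) + 1) (by omega) (by omega) (by omega)))
      gcongr
      omega
    · exact h.trans_le (two_mul_sq_le_iteratedExp_three (by omega) (by omega) (by omega))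
  refine h1.trans_le ?_
  rw [hY, ← iteratedExp_add]
  refine (iteratedExp_le_iteratedExp_one _ _).trans_eq ?_
  congr 1
  ring

theorem theorem3 (k : ℕ) (hk : 1 ≤ k) :
    ∃ c : ℝ, 0 < c ∧ ∃ n₀ : ℕ, ∀ n : ℕ, n₀ ≤ n →
      (∃ G : SimpleGraph (Fin n), IsRegularTree (2 * k) G) →
        ∀ (A : LocalAlgorithm k (Fin 2)) (T : ℕ),
          A.FindsWeakColoring n T (1 / 2) → c * (logStar n : ℝ) ≤ (T : ℝ) := by
  set D := 8 + 2 * (2 * k + 1) ^ 2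
  refine ⟨1 / (5 + D), by positivity, iteratedExp D 1, fun n hn hG A T hA => ?_⟩
  have h := hA.card_lt_iteratedExp hk hG
  -- The choice of `n₀` excludes `T = 0`, so that the additive constant `D` can be absorbed into `D
  -- * T`.
  have hT : 1 ≤ T := by
    rcases T with _ | T
    · rw [mul_zero, zero_add] at h
      exact absurd h (not_lt.2 hn)
    · omega
  have h1 : logStar n ≤ 5 * T + D := logStar_le_of_le_iteratedExp (by exact_mod_cast h.le)
  have h2 : (logStar n : ℝ) ≤ (5 + D) * T := by
    have : logStar n ≤ (5 + D) * T := by nlinarith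
    exact_mod_cast this
  rw [one_div_mul_eq_div, div_le_iff₀ (by positivity), mul_comm]
  exact h2
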